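/- **Theorem 3.6 (CCP Confidence Interval).** Let $\mathbb X\subset\mathbb R^n$ be compact and convex, $c\in\mathbb R^n$, let $\mathcal D$ be a metric space with its Borel $\sigma$-algebra, $\mathbb P$ a probability measure on $\mathcal D$, and $f:\mathbb X\times\mathcal D\to\mathbb R$ a Borel measurable function such that $x\mapsto f(x,d)$ is convex for each $d\in\mathcal D$ and $d\mapsto f(x,d)$ is bounded for each $x\in\mathbb X$. Let $\varepsilon,\beta\in[0,1]$. Let $$J^\star_{\mathrm{CCP}}=\inf\{c^\top x : x\in\mathbb X,\ \mathbb P[f(x,d)\le 0]\ge 1-\varepsilon\},$$ and, for a sample $(d_1,\dots,d_N)\in\mathcal D^N$, let $J^\star_N$ be the optimal value of the scenario program $$\mathrm{SCP}:\quad \min\{c^\top x : x\in\mathbb X,\ f(x,d_i)\le 0,\ i=1,\dots,N\}.$$ For $N\in\mathbb N$, assume that for each $(d_1,\dots,d_N)\in\mathcal D^N$ the program SCP has a unique optimizer $x^\star_N$ and that $(d_i)_{i=1}^N\mapsto x^\star_N$ is a Borel measurable map from $\mathcal D^N$ to $\mathbb X$. Suppose there is $x_0\in\mathbb X$ with $\sup_{d\in\mathcal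 D} f(x_0,d)<0$, and put $$L_{\mathrm{SP}}=\frac{\min_{x\in\mathbb X}c^\top x-c^\top x_0}{\sup_{d\in\mathcal D}f(x_0,d)}.$$ For $x\in\mathbb X$ and $\delta\ge0$ let $p(x,\delta)=\mathbb P\big[\sup_{v\in\mathcal D}f(x,v)-\delta<f(x,d)\big]$, and let $h:[0,1]\to[0,\infty]$ be a uniform level-set bound, that is, $$h(\varepsilon')\ \ge\ \sup\Big\{\delta\ge0 : \inf_{x\in\mathbb X}p(x,\delta)\le\varepsilon'\Big\}\qquad\text{for all }\varepsilon'\in[0,1],$$ the supremum being taken in $[0,\infty]$. Let $$N(\varepsilon,\beta)=\min\Big\{N\in\mathbb N : \sum_{i=0}^{n-1}\binom Ni\varepsilon^i(1-\varepsilon)^{N-i}\le\beta\Big\}\qquad(=\infty\text{ if there is no such }N).$$ For each $(d_i)_{i=1}^N$ let $\lambda^\star_N$ be a dual optimizer of SCP, i.e. a maximizer over $\lambda\in\mathbb R^N_{\ge0}$ of $\inf_{x\in\mathbb X}\big(c^\top x+\sum_{i=1}^N\lambda_i f(x,d_i)\big)$. Then, for all $N\ge N(\varepsilon,\beta)$,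 where $\mathbb P^N$ is the $N$-fold product measure, $$\text{(a priori)}\qquad \mathbb P^N\big[J^\star_{\mathrm{CCP}}-J^\star_N\in[-I(\varepsilon),0]\big]\ge1-\beta,$$ $$\text{(a posteriori)}\qquad \mathbb P^N\big[J^\star_{\mathrm{CCP}}-J^\star_N\in[-I_N(\varepsilon),0]\big]\ge1-\beta,$$ where, with $0\cdot\infty=0$, $$I(\varepsilon)=\min\Big\{L_{\mathrm{SP}}\,h(\varepsilon),\ \max_{x\in\mathbb X}c^\top x-\min_{x\in\mathbb X}c^\top x\Big\},\qquad I_N(\varepsilon)=\min\Big\{\|\lambda^\star_N\|_1\,h(\varepsilon),\ \max_{x\in\mathbb X}c^\top x-\min_{x\in\mathbb X}c^\top x\Big\}.$$ Both statements hold in the sense that the event contains a measurable event of probability at least $1-\beta$; in particular $\lambda^\star_N$ need not depend measurably on the samples. -/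

import Mathlib

open MeasureTheory Set
open scoped ENNReal NNReal

noncomputable section

namespace ScenarioProgram

/-- The optimal value `min {cᵀx : x ∈ S}` of the linear objective over a feasible set
(an infimum; `S` is nonempty and bounded wherever this is used). -/
def optVal {n : ℕ} (c : Fin n → ℝ) (S : Set (Fin n → ℝ)) : ℝ :=
  sInf ((fun x => c ⬝ᵥ x) '' S)

/-- `max {cᵀx : x ∈ S}`. -/
def maxVal {n : ℕ} (c : Fin n → ℝ) (S : Set (Fin n → ℝ)) : ℝ :=
  sSup ((fun x => c ⬝ᵥ x) '' S)

/-- `x` is the one and only minimizer of `cᵀx` over `S`. -/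
def IsUniqueMinimizer {n : ℕ} (c : Fin n → ℝ) (S : Set (Fin n → ℝ)) (x : Fin n → ℝ) : Prop :=
  x ∈ S ∧ ∀ y ∈ S, c ⬝ᵥ y ≤ c ⬝ᵥ x → y = x

/-- Feasible set of the chance-constrained program with violation level `ε`. Only the values of
`f` on `X × D` matter, here and below. -/
def ccpFeasible {n : ℕ} {D : Type*} [MeasurableSpace D] (X : Set (Fin n → ℝ))
    (f : (Fin n → ℝ) → D → ℝ) (P : Measure D) (ε : ℝ) : Set (Fin n → ℝ) :=
  {x | x ∈ X ∧ ENNReal.ofReal (1 - ε) ≤ P {d | f x d ≤ 0}}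

/-- Feasible set of the scenario program for the samples `d 0, …, d (N - 1)`. -/
def scpFeasible {n : ℕ} {D : Type*} (X : Set (Fin n → ℝ))
    (f : (Fin n → ℝ) → D → ℝ) {N : ℕ} (d : Fin N → D) : Set (Fin n → ℝ) :=
  {x | x ∈ X ∧ ∀ i, f x (d i) ≤ 0}

/-- Each sample tuple determines a unique optimizer of the scenario program, and the optimizer
depends on the samples in a Borel measurable way (Borel σ-algebra of the product space `D ^ N`). -/
def HasMeasurableOptimizer {n : ℕ} {D : Type*} [TopologicalSpace D] (X : Set (Fin n → ℝ))
    (c : Fin n → ℝ) (f : (Fin n → ℝ) → D → ℝ) (N : ℕ) : Prop :=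
  ∃ xstar : (Fin N → D) → (Fin n → ℝ),
    Measurable[borel (Fin N → D)] xstar ∧
      ∀ d : Fin N → D, IsUniqueMinimizer c (scpFeasible X f d) (xstar d)

/-- The Lagrange dual function `λ ↦ inf_{x ∈ X} (cᵀx + ∑ᵢ λᵢ f(x, dᵢ))` of the scenario program,
with values in the extended reals. -/
def scpDual {n : ℕ} {D : Type*} (X : Set (Fin n → ℝ)) (c : Fin n → ℝ)
    (f : (Fin n → ℝ) → D → ℝ) {N : ℕ} (d : Fin N → D) (l : Fin N → ℝ) : EReal :=
  ⨅ x ∈ X, ((c ⬝ᵥ x + ∑ i, l i * f x (d i) : ℝ) : EReal)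

/-- `l` is a dual optimizer: it maximizes the dual function over the nonnegative multipliers. -/
def IsDualOptimizer {n : ℕ} {D : Type*} (X : Set (Fin n → ℝ)) (c : Fin n → ℝ)
    (f : (Fin n → ℝ) → D → ℝ) {N : ℕ} (d : Fin N → D) (l : Fin N → ℝ) : Prop :=
  (∀ i, 0 ≤ l i) ∧ ∀ m : Fin N → ℝ, (∀ i, 0 ≤ m i) → scpDual X c f d m ≤ scpDual X c f d l

/-- The minimal sample size `N(ε, β)`; it is `⊤` when no sample size is large enough. -/
def sampleSize (n : ℕ) (ε β : ℝ) : ℕ∞ :=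
  sInf ((fun N : ℕ => (N : ℕ∞)) ''
    {N : ℕ | ∑ i ∈ Finset.range n, (N.choose i : ℝ) * ε ^ i * (1 - ε) ^ (N - i) ≤ β})

/-- The tail probability of the worst-case violation. -/
def tailProb {n : ℕ} {D : Type*} [MeasurableSpace D] (f : (Fin n → ℝ) → D → ℝ)
    (P : Measure D) (x : Fin n → ℝ) (δ : ℝ≥0) : ℝ≥0∞ :=
  P {d | (⨆ v, f x v) - δ < f x d}

/-- `h` is a uniform level-set bound. The supremum is taken in `[0, ∞]`, and `h` may take the
value `∞`: at level `1` the set of all `δ` is unbounded, so a bound cannot be finite there. -/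
def IsULB {n : ℕ} {D : Type*} [MeasurableSpace D] (X : Set (Fin n → ℝ))
    (f : (Fin n → ℝ) → D → ℝ) (P : Measure D) (h : ℝ → ℝ≥0∞) : Prop :=
  ∀ ε ∈ Icc (0 : ℝ) 1,
    sSup ((fun δ : ℝ≥0 => (δ : ℝ≥0∞)) ''
      {δ : ℝ≥0 | (⨅ x ∈ X, tailProb f P x δ) ≤ ENNReal.ofReal ε}) ≤ h ε

/-- The constant `(min_{x ∈ X} cᵀx - cᵀx₀) / sup_d f(x₀, d)` attached to a Slater point `x₀`. -/
def slaterConst {n : ℕ} {D : Type*} (X : Set (Fin n → ℝ)) (c : Fin n → ℝ)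
    (f : (Fin n → ℝ) → D → ℝ) (x₀ : Fin n → ℝ) : ℝ :=
  (optVal c X - c ⬝ᵥ x₀) / ⨆ d, f x₀ d

/-- `min {L · η, max_X cᵀx - min_X cᵀx}`, where `0 · ∞ = 0`. The minimum is finite. -/
def intervalLength {n : ℕ} (X : Set (Fin n → ℝ)) (c : Fin n → ℝ) (L : ℝ) (η : ℝ≥0∞) : ℝ :=
  (min (ENNReal.ofReal L * η) (ENNReal.ofReal (maxVal c X - optVal c X))).toReal

/-- The event `S` has probability at least `q`. No measurability of `S` is presupposed: `S` has to
contain a measurable event of probability at least `q`, which for a measurable `S` is the same as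
`q ≤ μ S`. -/
def ProbAtLeast {Ω : Type*} [MeasurableSpace Ω] (μ : Measure Ω) (q : ℝ) (S : Set Ω) : Prop :=
  ∃ A, MeasurableSet A ∧ A ⊆ S ∧ ENNReal.ofReal q ≤ μ A

end ScenarioProgram

end

/-! Let `z` be the scenario optimizer, and suppose that its violation probability is at most `ε`.
Then `z` is feasible for the chance-constrained program, whose value is therefore at most the
scenario value. Conversely, every chance-feasible `x` has P[f(x,·) > 0] ≤ ε, so the level-set bound
gives sup f(x,·) ≤ h(ε). Thus `x` solves the constraints relaxed by h(ε), and relaxing lowers the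
optimal value by at most a Lipschitz constant times h(ε). That constant comes from moving towards
the Slater point (a priori) or from a dual optimizer (a posteriori). The width of the objective over
`X` is the trivial alternative bound.

The probabilistic core is that violation probability above `ε` occurs with probability at most
`binomTail n N ε`. Draw N + m samples and let a uniformly random `N`-subset `R` define the program.
For generic strictly convex perturbations, the at most `n` active constraints A(R) and the violated
ones V(R) yield intervals [A(R), V(R)ᶜ] that partition the Boolean lattice. If all lower ends of
large sets have exactly `n` elements, counting sets of each size gives a triangular linear system,
so the distribution of |V(R)| is universal. Padding enforces size `n` and only adds violators, so
the tail of |V(R)| is dominated by an explicit order-statistics model (`card_violated_tail_le`).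
Compactness carries this count back to the original program (`card_violations_le`).

As m → ∞, the hypergeometric count tends to the binomial tail. By the law of large numbers, the
frequency of violated samples tends to the violation probability. Exchangeability and Fatou's lemma
then give `measure_optimizer_violation_le`. -/

namespace ScenarioProgram

/-! ### Interval partitions of the Boolean lattice -/

/-- The assignment `R ↦ [A R, (V R)ᶜ]` partitions the Boolean lattice into intervals. -/
structure IsIntervalPartition {ι : Type*} (A V : Finset ι → Finset ι) : Prop where
  subset : ∀ R, A R ⊆ R
  disjoint : ∀ R, Disjoint (V R) R
  stable : ∀ R T, A R ⊆ T → Disjoint (V R) T → A T = A R ∧ V T = V R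

namespace IsIntervalPartition

variable {M : ℕ} {A V A' V' : Finset (Fin M) → Finset (Fin M)} {n : ℕ}

lemma self (h : IsIntervalPartition A V) (R : Finset (Fin M)) :
    A (A R) = A R ∧ V (A R) = V R :=
  h.stable R (A R) subset_rfl ((h.disjoint R).mono_right (h.subset R))

/-- The fiber over `I` is the interval from `I` to the complement of `V I`; the remaining m - n
elements are free among those outside `I` and `V I`. -/
lemma fiber_card (h : IsIntervalPartition A V) {m : ℕ} {I : Finset (Fin M)}
    (hI : A I = I) (hIn : I.card = n) (hm : n ≤ m) :
    ((Finset.powersetCard m Finset.univ).filter (fun R => A R = I)).card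
      = (M - n - (V I).card).choose (m - n) := by
  have hdisj : Disjoint (V I) I := h.disjoint I
  have hc : (Finset.univ \ (V I ∪ I)).card = M - n - (V I).card := by
    rw [Finset.card_sdiff_of_subset (Finset.subset_univ _), Finset.card_union_of_disjoint hdisj,
      Finset.card_univ, Fintype.card_fin]
    omega
  rw [← hc, ← Finset.card_powersetCard]
  refine Finset.card_bij' (fun R _ => R \ I) (fun T _ => T ∪ I) ?_ ?_ ?_ ?_
  · intro R hR
    simp only [Finset.mem_filter, Finset.mem_powersetCard, Finset.subset_univ, true_and] at hR
    obtain ⟨hRm, rfl⟩ := hR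
    have h1 := h.subset R
    have h2 := h.disjoint R
    rw [(h.self R).2]
    simp only [Finset.mem_powersetCard]
    refine ⟨?_, by rw [Finset.card_sdiff_of_subset h1, hRm, hIn]⟩
    intro x hx
    simp only [Finset.mem_sdiff, Finset.mem_univ, true_and, Finset.mem_union, not_or] at hx ⊢
    exact ⟨fun hv => Finset.disjoint_left.1 h2 hv hx.1, hx.2⟩
  · intro T hT
    simp only [Finset.mem_powersetCard, Finset.mem_filter, Finset.subset_univ, true_and] at hT ⊢
    have hd : Disjoint T I := by
      rw [Finset.disjoint_left]
      intro x hx hxI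
      have := hT.1 hx
      simp [hxI] at this
    refine ⟨by rw [Finset.card_union_of_disjoint hd, hT.2, hIn]; omega, ?_⟩
    have := h.stable I (T ∪ I) (by rw [hI]; exact Finset.subset_union_right) (by
      rw [Finset.disjoint_left]
      intro x hx hxT
      rcases Finset.mem_union.1 hxT with hxT | hxI
      · have := hT.1 hxT
        simp [hx] at this
      · exact Finset.disjoint_left.1 hdisj hx hxI)
    rw [this.1, hI]
  · intro R hR
    simp only [Finset.mem_filter] at hR
    rw [Finset.sdiff_union_of_subset]
    rw [← hR.2]; exact h.subset R
  · intro T hT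
    simp only [Finset.mem_powersetCard] at hT
    have hd : Disjoint T I := by
      rw [Finset.disjoint_left]
      intro x hx hxI
      have := hT.1 hx
      simp [hxI] at this
    exact Finset.union_sdiff_cancel_right hd

lemma card_violated_le (h : IsIntervalPartition A V) {I : Finset (Fin M)} (hIn : I.card = n) :
    (V I).card + n ≤ M := by
  rw [← hIn, ← Finset.card_union_of_disjoint (h.disjoint I)]
  simpa using Finset.card_le_univ (V I ∪ I)

/-- The number of `n`-element sets with exactly `k` violators. -/
def levelCard (V : Finset (Fin M) → Finset (Fin M)) (n k : ℕ) : ℕ :=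
  ((Finset.powersetCard n Finset.univ).filter (fun I => (V I).card = k)).card

/-- `V` is constant on the fibers of `A`, so the count splits over the possible lower ends, which
are grouped by their number of violators. -/
lemma sum_level (h : IsIntervalPartition A V) (hA : ∀ R, n ≤ R.card → (A R).card = n)
    {m : ℕ} (hm : n ≤ m) (p : ℕ → Prop) [DecidablePred p] :
    ((Finset.powersetCard m Finset.univ).filter (fun R => p (V R).card)).card
      = ∑ k ∈ (Finset.range (M - n + 1)).filter p,
          levelCard V n k * (M - n - k).choose (m - n) := by
  have key : ((Finset.powersetCard m Finset.univ).filter (fun R => p (V R).card)).card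
      = ∑ I ∈ (Finset.powersetCard n Finset.univ).filter (fun I => p (V I).card),
          (M - n - (V I).card).choose (m - n) := by
    rw [Finset.card_eq_sum_card_fiberwise (f := A)
      (t := (Finset.powersetCard n Finset.univ).filter (fun I => p (V I).card))]
    · refine Finset.sum_congr rfl fun I hI => ?_
      simp only [Finset.mem_filter, Finset.mem_powersetCard, Finset.subset_univ, true_and] at hI
      have hAI : A I = I :=
        Finset.eq_of_subset_of_card_le (h.subset I) (by rw [hA I hI.1.ge, hI.1])
      rw [← h.fiber_card hAI hI.1 hm]
      congr 1
      ext R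
      simp only [Finset.mem_filter, Finset.mem_powersetCard, Finset.subset_univ, true_and]
      constructor
      · rintro ⟨⟨h1, -⟩, h2⟩; exact ⟨h1, h2⟩
      · rintro ⟨h1, h2⟩
        refine ⟨⟨h1, ?_⟩, h2⟩
        rw [← (h.self R).2, h2]; exact hI.2
    · intro R hR
      simp only [Finset.coe_filter, Finset.mem_powersetCard, Finset.subset_univ, true_and,
        Set.mem_ofPred_eq] at hR ⊢
      rw [(h.self R).2]
      exact ⟨hA R (by omega), hR.2⟩
  rw [key]
  rw [← Finset.sum_fiberwise_of_maps_to (g := fun I => (V I).card)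
    (t := (Finset.range (M - n + 1)).filter p)]
  · refine Finset.sum_congr rfl fun k hk => ?_
    rw [Finset.mem_filter] at hk
    rw [levelCard, ← smul_eq_mul, ← Finset.sum_const]
    refine Finset.sum_congr ?_ ?_
    · ext I
      simp only [Finset.mem_filter]
      constructor
      · rintro ⟨⟨h1, -⟩, h2⟩; exact ⟨h1, h2⟩
      · rintro ⟨h1, h2⟩; exact ⟨⟨h1, h2 ▸ hk.2⟩, h2⟩
    · intro I hI
      rw [Finset.mem_filter] at hI
      rw [hI.2]
  · intro I hI
    simp only [Finset.mem_filter, Finset.mem_powersetCard, Finset.subset_univ, true_and,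
      Finset.mem_range] at hI ⊢
    have := h.card_violated_le hI.1
    exact ⟨by omega, hI.2⟩

/-- Taking t = L - k kills all terms with index above `k` and gives index `k` coefficient 1: the
system is unitriangular. -/
lemma choose_system_injective {L : ℕ} {b b' : ℕ → ℕ}
    (h : ∀ t ≤ L, ∑ k ∈ Finset.range (L + 1), b k * (L - k).choose t
      = ∑ k ∈ Finset.range (L + 1), b' k * (L - k).choose t) :
    ∀ k ≤ L, b k = b' k := by
  intro k
  induction k using Nat.strong_induction_on with
  | _ k ih =>
    intro hk
    have hs : ∀ a : ℕ → ℕ, ∑ j ∈ Finset.range (L + 1), a j * (L - j).choose (L - k)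
        = (∑ j ∈ Finset.range k, a j * (L - j).choose (L - k)) + a k := by
      intro a
      rw [← Finset.sum_subset (s₁ := Finset.range (k + 1))]
      · rw [Finset.sum_range_succ, Nat.choose_self, mul_one]
      · intro x; simp only [Finset.mem_range]; omega
      · intro x hx hx'
        simp only [Finset.mem_range] at hx hx'
        rw [Nat.choose_eq_zero_of_lt (by omega), mul_zero]
    have h1 := h (L - k) (by omega)
    rw [hs, hs, Finset.sum_congr rfl (g := fun j => b' j * (L - j).choose (L - k))] at h1
    · omega
    · intro j hj
      rw [Finset.mem_range] at hj
      rw [ih j hj (by omega)]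

/-- With no condition on the violators, the left side of `sum_level` counts all sets of size n + t,
whatever the partition; these totals determine the level counts. -/
lemma levelCard_eq (h : IsIntervalPartition A V) (hA : ∀ R, n ≤ R.card → (A R).card = n)
    (h' : IsIntervalPartition A' V') (hA' : ∀ R, n ≤ R.card → (A' R).card = n) :
    ∀ k ≤ M - n, levelCard V n k = levelCard V' n k := by
  apply choose_system_injective
  intro t ht
  have h1 := h.sum_level hA (m := n + t) (by omega) (fun _ => True)
  have h2 := h'.sum_level hA' (m := n + t) (by omega) (fun _ => True)
  simp only [Finset.filter_true, Nat.add_sub_cancel_left] at h1 h2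
  rw [← h1, ← h2]

lemma card_filter_eq (h : IsIntervalPartition A V) (hA : ∀ R, n ≤ R.card → (A R).card = n)
    (h' : IsIntervalPartition A' V') (hA' : ∀ R, n ≤ R.card → (A' R).card = n)
    {m : ℕ} (hm : n ≤ m) (p : ℕ → Prop) [DecidablePred p] :
    ((Finset.powersetCard m Finset.univ).filter (fun R => p (V R).card)).card
      = ((Finset.powersetCard m Finset.univ).filter (fun R => p (V' R).card)).card := by
  rw [h.sum_level hA hm, h'.sum_level hA' hm]
  refine Finset.sum_congr rfl fun k hk => ?_
  simp only [Finset.mem_filter, Finset.mem_range] at hk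
  rw [h.levelCard_eq hA h' hA' k (by omega)]

/-- Enlarge the lower end of each interval to `n` elements, in the order of `Fin M`. -/
def padLower (n : ℕ) (A : Finset (Fin M) → Finset (Fin M)) (R : Finset (Fin M)) :
    Finset (Fin M) :=
  A R ∪ (R \ A R).filter (fun j => (A R).card + ((R \ A R).filter (· < j)).card < n)

/-- The violators belonging to `padLower`. -/
def padViolated (n : ℕ) (A V : Finset (Fin M) → Finset (Fin M)) (R : Finset (Fin M)) :
    Finset (Fin M) :=
  V R ∪ Rᶜ.filter (fun j => (A R).card + ((R \ A R).filter (· < j)).card < n)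

/-- Reading the indices in order, membership in `R` is prescribed until `n` elements have been
collected, those of `A R` counting from the start. A set `T` in the new interval makes the same
choices, so the reading stops at the same place for `T`. -/
lemma pad (h : IsIntervalPartition A V) (n : ℕ) :
    IsIntervalPartition (padLower n A) (padViolated n A V) := by
  refine ⟨fun R => ?_, fun R => ?_, fun R T hAT hVT => ?_⟩
  · exact Finset.union_subset (h.subset R)
      ((Finset.filter_subset _ _).trans Finset.sdiff_subset)
  · rw [padViolated, Finset.disjoint_union_left]
    refine ⟨h.disjoint R, ?_⟩
    exact disjoint_compl_left.mono_left (Finset.filter_subset _ _)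
  · obtain ⟨hA, hV⟩ := h.stable R T (Finset.subset_union_left.trans hAT)
      (hVT.mono_left Finset.subset_union_left)
    have hmem : ∀ j, (A R).card + ((R \ A R).filter (· < j)).card < n → (j ∈ T ↔ j ∈ R) := by
      intro j hj
      constructor
      · intro hjT
        by_contra hjR
        refine Finset.disjoint_left.1 hVT ?_ hjT
        exact Finset.mem_union_right _ (by simp [hjR, hj])
      · intro hjR
        apply hAT
        by_cases hjA : j ∈ A R
        · exact Finset.mem_union_left _ hjA
        · exact Finset.mem_union_right _ (by simp [hjR, hjA, hj])
    have hmono : ∀ (S : Finset (Fin M)) (i j : Fin M), i ≤ j →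
        (S.filter (· < i)).card ≤ (S.filter (· < j)).card := by
      intro S i j hij
      refine Finset.card_le_card fun x hx => ?_
      simp only [Finset.mem_filter] at hx ⊢
      exact ⟨hx.1, hx.2.trans_le hij⟩
    have hfil : ∀ j, (∀ i < j, (i ∈ T ↔ i ∈ R)) →
        (T \ A R).filter (· < j) = (R \ A R).filter (· < j) := by
      intro j hj
      ext x
      simp only [Finset.mem_filter, Finset.mem_sdiff]
      constructor
      · rintro ⟨⟨a, b⟩, c⟩; exact ⟨⟨(hj x c).1 a, b⟩, c⟩
      · rintro ⟨⟨a, b⟩, c⟩; exact ⟨⟨(hj x c).2 a, b⟩, c⟩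
    have hiff : ∀ j : Fin M, (A R).card + ((T \ A R).filter (· < j)).card < n ↔
        (A R).card + ((R \ A R).filter (· < j)).card < n := by
      -- Induction along the order: below `j` the sets `T` and `R` agree, hence their prefix counts
      -- at `j` agree.
      intro j
      induction j using WellFoundedLT.induction with
      | _ j ih =>
        constructor
        · intro hj
          rw [← hfil j]
          · exact hj
          · intro i hi
            refine hmem i ((ih i hi).1 ?_)
            have := hmono (T \ A R) i j hi.le
            omega
        · intro hj
          rw [hfil j]
          · exact hj
          · intro i hi
            refine hmem i ?_
            have := hmono (R \ A R) i j hi.le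
            omega
    constructor
    · unfold padLower
      rw [hA]
      congr 1
      ext j
      simp only [Finset.mem_filter, Finset.mem_sdiff, hiff j]
      constructor
      · rintro ⟨⟨a, b⟩, c⟩; exact ⟨⟨(hmem j c).1 a, b⟩, c⟩
      · rintro ⟨⟨a, b⟩, c⟩; exact ⟨⟨(hmem j c).2 a, b⟩, c⟩
    · unfold padViolated
      rw [hA, hV]
      congr 1
      ext j
      simp only [Finset.mem_filter, Finset.mem_compl, hiff j]
      constructor
      · rintro ⟨a, c⟩; exact ⟨fun hj => a ((hmem j c).2 hj), c⟩
      · rintro ⟨a, c⟩; exact ⟨fun hj => a ((hmem j c).1 hj), c⟩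

lemma card_initial (S : Finset (Fin M)) : ∀ r ≤ S.card,
    (S.filter (fun j => (S.filter (· < j)).card < r)).card = r := by
  induction S using Finset.induction_on_max with
  | empty => simp
  | insert a S ha ih =>
    have haS : a ∉ S := fun h => lt_irrefl _ (ha a h)
    intro r hr
    rw [Finset.card_insert_of_notMem haS] at hr
    have hlt : ∀ j ∈ S, (insert a S).filter (· < j) = S.filter (· < j) := by
      intro j hj
      rw [Finset.filter_insert, if_neg (not_lt.2 (ha j hj).le)]
    have hla : (insert a S).filter (· < a) = S := by
      rw [Finset.filter_insert, if_neg (lt_irrefl _), Finset.filter_true_of_mem ha]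
    rw [Finset.filter_insert, hla, Finset.filter_congr (q := fun j => (S.filter (· < j)).card < r)
      (fun j hj => by rw [hlt j hj])]
    split_ifs with hc
    · rw [Finset.card_insert_of_notMem (by simp [haS]), Finset.filter_true_of_mem]
      · omega
      · intro j hj
        exact (Finset.card_le_card (Finset.filter_subset _ _)).trans_lt hc
    · exact ih r (by omega)

lemma card_padLower (h : IsIntervalPartition A V) (hA : ∀ R, (A R).card ≤ n)
    (R : Finset (Fin M)) (hR : n ≤ R.card) : (padLower n A R).card = n := by
  rw [padLower, Finset.card_union_of_disjoint]
  · have h1 := card_initial (R \ A R) (n - (A R).card) (by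
      rw [Finset.card_sdiff_of_subset (h.subset R)]; omega)
    have h2 := hA R
    rw [Finset.filter_congr (q := fun j => ((R \ A R).filter (· < j)).card < n - (A R).card), h1]
    · omega
    · intro j _
      omega
  · exact Finset.disjoint_sdiff.mono_right (Finset.filter_subset _ _)

lemma trivial_partition :
    IsIntervalPartition (fun _ : Finset (Fin M) => (∅ : Finset (Fin M))) (fun _ => ∅) :=
  ⟨fun _ => by simp, fun _ => by simp, fun _ _ _ _ => by simp⟩

/-- Tail bound for the number of violators of a uniformly random `m`-element set. -/
theorem card_violated_tail_le (h : IsIntervalPartition A V) (hA : ∀ R, (A R).card ≤ n)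
    {m : ℕ} (hm : n ≤ m) (k : ℕ) :
    ((Finset.powersetCard m Finset.univ).filter (fun R => k < (V R).card)).card
      ≤ ((Finset.powersetCard m Finset.univ).filter (fun R : Finset (Fin M) =>
          (R.filter (fun j : Fin M => (j : ℕ) < k + n)).card < n)).card := by
  have h0 := trivial_partition (M := M)
  calc ((Finset.powersetCard m Finset.univ).filter (fun R => k < (V R).card)).card
      ≤ ((Finset.powersetCard m Finset.univ).filter
          (fun R => k < (padViolated n A V R).card)).card := by
        refine Finset.card_le_card fun R hR => ?_
        rw [Finset.mem_filter] at hR ⊢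
        exact ⟨hR.1, hR.2.trans_le (Finset.card_le_card Finset.subset_union_left)⟩
    _ = ((Finset.powersetCard m Finset.univ).filter (fun R : Finset (Fin M) =>
          k < (padViolated n (fun _ => ∅) (fun _ => ∅) R).card)).card :=
        (h.pad n).card_filter_eq (h.card_padLower hA) (h0.pad n)
          (h0.card_padLower (fun _ => by simp)) hm (fun j => k < j)
    -- For the padded trivial partition, the violators are the non-elements of `R` preceded by fewer
    -- than `n` elements of `R`. If `n` elements of `R` lie among the first k + n indices, at most
    -- `k` places there remain for violators.
    _ ≤ _ := by
        refine Finset.card_le_card fun R hR => ?_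
        rw [Finset.mem_filter] at hR ⊢
        refine ⟨hR.1, ?_⟩
        by_contra hcon
        push Not at hcon
        have hsub : padViolated n (fun _ => ∅) (fun _ => ∅) R
            ⊆ (Finset.univ.filter (fun j : Fin M => (j : ℕ) < k + n)) \
              (R.filter (fun j : Fin M => (j : ℕ) < k + n)) := by
          intro j hj
          simp only [padViolated, Finset.empty_union, Finset.mem_filter, Finset.mem_compl,
            Finset.card_empty, zero_add, Finset.sdiff_empty] at hj
          have hjk : (j : ℕ) < k + n := by
            by_contra hjk
            have : (R.filter (fun j : Fin M => (j : ℕ) < k + n)).card ≤ (R.filter (· < j)).card := by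
              refine Finset.card_le_card fun x hx => ?_
              simp only [Finset.mem_filter] at hx ⊢
              exact ⟨hx.1, Fin.lt_def.2 (by omega)⟩
            omega
          simp [hj.1, hjk]
        have h1 := Finset.card_le_card hsub
        rw [Finset.card_sdiff_of_subset (Finset.filter_subset_filter _ (Finset.subset_univ _))]
          at h1
        have h2 : (Finset.univ.filter (fun j : Fin M => (j : ℕ) < k + n)).card ≤ k + n := by
          rw [← Finset.card_map Fin.valEmbedding]
          calc _ ≤ (Finset.range (k + n)).card := by
                refine Finset.card_le_card fun x hx => ?_
                simp only [Finset.mem_map, Finset.mem_filter, Finset.mem_univ, true_and,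
                  Fin.valEmbedding_apply] at hx
                obtain ⟨y, hy, rfl⟩ := hx
                exact Finset.mem_range.2 hy
            _ = k + n := Finset.card_range _
        omega

end IsIntervalPartition

/-! ### Helly's theorem -/

/-- Helly's theorem for convex programs: some subfamily of prescribed size at least `n` already has
the optimal value of the whole family. -/
lemma exists_subfamily_optimal {n : ℕ} {ι : Type*} [DecidableEq ι]
    {K : ι → Set (Fin n → ℝ)} {S : Finset ι} (hconv : ∀ i ∈ S, Convex ℝ (K i))
    {φ : (Fin n → ℝ) → ℝ} (hφ : ∀ r, Convex ℝ {x | φ x ≤ r})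
    {x₀ : Fin n → ℝ} (hx₀ : ∀ i ∈ S, x₀ ∈ K i) {k : ℕ} (hk : n ≤ k) (hkS : k ≤ S.card)
    {y : Finset ι → (Fin n → ℝ)} (hy : ∀ I ⊆ S, I.card = k → ∀ i ∈ I, y I ∈ K i) :
    ∃ I ⊆ S, I.card = k ∧ ∃ z, (∀ i ∈ S, z ∈ K i) ∧ φ z ≤ φ (y I) := by
  -- Take the subfamily with the largest value and add its sublevel set to the family. Of n + 1
  -- members including it, only `n` are constraints, and these are met by the point of any larger
  -- `k`-subfamily.
  obtain ⟨I, hI, hmax⟩ := Finset.exists_max_image (Finset.powersetCard k S) (fun I => φ (y I))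
    (Finset.powersetCard_nonempty.2 hkS)
  rw [Finset.mem_powersetCard] at hI
  refine ⟨I, hI.1, hI.2, ?_⟩
  let F : Option ι → Set (Fin n → ℝ) := fun o => o.elim {x | φ x ≤ φ (y I)} K
  have hne : (⋂ o ∈ Finset.insertNone S, F o).Nonempty := by
    refine Convex.helly_theorem (𝕜 := ℝ) ?_ ?_ ?_
    · rw [Module.finrank_fin_fun, Finset.card_insertNone]; omega
    · intro o ho
      cases o with
      | none => exact hφ _
      | some i => exact hconv i (by simpa using ho)
    · intro J hJS hJ
      rw [Module.finrank_fin_fun] at hJ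
      by_cases hnone : none ∈ J
      · have hT : (Finset.eraseNone J).card ≤ k := by
          rw [Finset.card_eraseNone_of_mem hnone]; omega
        obtain ⟨T, hJT, hTS, hTk⟩ := Finset.exists_subsuperset_card_eq
          (s := Finset.eraseNone J) (t := S) (n := k) (by
            intro i hi
            rw [Finset.mem_eraseNone] at hi
            simpa using hJS hi) hT hkS
        refine ⟨y T, ?_⟩
        rw [mem_iInter₂]
        intro o ho
        cases o with
        | none => exact hmax T (Finset.mem_powersetCard.2 ⟨hTS, hTk⟩)
        | some i => exact hy T hTS hTk i (hJT (Finset.mem_eraseNone.2 ho))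
      · refine ⟨x₀, ?_⟩
        rw [mem_iInter₂]
        intro o ho
        cases o with
        | none => exact absurd ho hnone
        | some i => exact hx₀ i (by simpa using hJS ho)
  obtain ⟨z, hz⟩ := hne
  rw [mem_iInter₂] at hz
  exact ⟨z, fun i hi => hz (some i) (by simpa using hi), hz none (by simp)⟩

/-! ### Strictly convex objective -/

/-- The linear objective with a strictly convex perturbation. -/
def regObj {n : ℕ} (c : Fin n → ℝ) (δ : ℝ) (x : Fin n → ℝ) : ℝ :=
  c ⬝ᵥ x + δ * ∑ i, x i ^ 2

section Regularized

variable {n : ℕ} {c : Fin n → ℝ} {δ : ℝ}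

lemma regObj_combo (x y : Fin n → ℝ) (t : ℝ) :
    regObj c δ (x + t • (y - x)) = (1 - t) * regObj c δ x + t * regObj c δ y
      - δ * (t * (1 - t) * ∑ i, (x i - y i) ^ 2) := by
  have h : ∑ i, (x + t • (y - x)) i ^ 2 = (1 - t) * ∑ i, x i ^ 2 + t * ∑ i, y i ^ 2
      - t * (1 - t) * ∑ i, (x i - y i) ^ 2 := by
    rw [Finset.mul_sum, Finset.mul_sum, Finset.mul_sum, ← Finset.sum_add_distrib,
      ← Finset.sum_sub_distrib]
    refine Finset.sum_congr rfl fun i _ => ?_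
    simp only [Pi.add_apply, Pi.smul_apply, Pi.sub_apply, smul_eq_mul]
    ring
  simp only [regObj, h, dotProduct_add, dotProduct_smul, dotProduct_sub, smul_eq_mul]
  ring

lemma regObj_combo_le (hδ : 0 ≤ δ) (x y : Fin n → ℝ) {t : ℝ} (ht0 : 0 ≤ t) (ht1 : t ≤ 1) :
    regObj c δ (x + t • (y - x)) ≤ (1 - t) * regObj c δ x + t * regObj c δ y := by
  rw [regObj_combo]
  have : 0 ≤ δ * (t * (1 - t) * ∑ i, (x i - y i) ^ 2) :=
    mul_nonneg hδ (mul_nonneg (mul_nonneg ht0 (by linarith))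
      (Finset.sum_nonneg fun i _ => sq_nonneg _))
  linarith

lemma convex_regObj_le (hδ : 0 ≤ δ) (r : ℝ) : Convex ℝ {x | regObj c δ x ≤ r} := by
  intro x hx y hy a b ha hb hab
  have h := regObj_combo_le (c := c) hδ x y hb (by linarith)
  have e : a • x + b • y = x + b • (y - x) := by
    rw [show a = 1 - b by linarith]; module
  rw [mem_ofPred_eq, e]
  rw [mem_ofPred_eq] at hx hy
  nlinarith

lemma continuous_regObj : Continuous (regObj c δ) := by
  unfold regObj dotProduct
  fun_prop

lemma eq_of_regObj_le (hδ : 0 < δ) {F : Set (Fin n → ℝ)} (hF : Convex ℝ F)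
    {z y : Fin n → ℝ} (hz : z ∈ F) (hmin : ∀ x ∈ F, regObj c δ z ≤ regObj c δ x)
    (hy : y ∈ F) (hle : regObj c δ y ≤ regObj c δ z) : y = z := by
  by_contra hne
  have hpos : 0 < ∑ i, (z i - y i) ^ 2 := by
    obtain ⟨i, hi⟩ := Function.ne_iff.1 hne
    refine Finset.sum_pos' (fun i _ => sq_nonneg _) ⟨i, Finset.mem_univ _, ?_⟩
    exact sq_pos_of_ne_zero (sub_ne_zero.2 (Ne.symm hi))
  have hmem : z + (1 / 2 : ℝ) • (y - z) ∈ F := by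
    have := hF hz hy (show (0 : ℝ) ≤ 1 / 2 by norm_num) (show (0 : ℝ) ≤ 1 / 2 by norm_num)
      (by norm_num)
    convert this using 1
    module
  have h1 := hmin _ hmem
  rw [regObj_combo] at h1
  nlinarith [mul_pos hδ hpos]

end Regularized

/-! ### Generic perturbations of the constraints -/

section Perturbed

open Metric

variable {n : ℕ} {ι : Type*}

/-- The feasible set with each constraint relaxed to a closed neighbourhood. -/
def relaxed (X : Set (Fin n → ℝ)) (K : ι → Set (Fin n → ℝ)) (η : ι → ℝ) (R : Finset ι) :
    Set (Fin n → ℝ) :=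
  {x | x ∈ X ∧ ∀ i ∈ R, infDist x (K i) ≤ η i}

lemma convex_infDist_le {s : Set (Fin n → ℝ)} (hs : Convex ℝ s) (hne : s.Nonempty) {r : ℝ}
    (hr : 0 ≤ r) : Convex ℝ {x | infDist x s ≤ r} := by
  have : {x | infDist x s ≤ r} = cthickening r s := by
    ext x
    rw [mem_cthickening_iff, mem_ofPred_eq, infDist,
      ENNReal.le_ofReal_iff_toReal_le (infEDist_ne_top hne) hr]
  rw [this]
  exact hs.cthickening r

variable {X : Set (Fin n → ℝ)} {K : ι → Set (Fin n → ℝ)} {η : ι → ℝ} {R : Finset ι}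
  {c : Fin n → ℝ} {δ : ℝ}

lemma convex_relaxed (hX : Convex ℝ X) (hK : ∀ i, Convex ℝ (K i)) (hne : ∀ i, (K i).Nonempty)
    (hη : ∀ i, 0 < η i) : Convex ℝ (relaxed X K η R) := by
  have : relaxed X K η R = X ∩ ⋂ i ∈ R, {x | infDist x (K i) ≤ η i} := by
    ext x; simp [relaxed]
  rw [this]
  exact hX.inter (convex_iInter₂ fun i _ => convex_infDist_le (hK i) (hne i) (hη i).le)

lemma isCompact_relaxed (hX : IsCompact X) : IsCompact (relaxed X K η R) := by
  have : relaxed X K η R = X ∩ ⋂ i ∈ R, {x | infDist x (K i) ≤ η i} := by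
    ext x; simp [relaxed]
  rw [this]
  exact hX.inter_right (isClosed_biInter fun i _ =>
    isClosed_le (continuous_infDist_pt _) continuous_const)

/-- `z` minimizes the regularized objective over the relaxed feasible set. -/
def IsRelaxedMin (X : Set (Fin n → ℝ)) (K : ι → Set (Fin n → ℝ)) (η : ι → ℝ) (c : Fin n → ℝ)
    (δ : ℝ) (R : Finset ι) (z : Fin n → ℝ) : Prop :=
  z ∈ relaxed X K η R ∧ ∀ y ∈ relaxed X K η R, regObj c δ z ≤ regObj c δ y

lemma exists_isRelaxedMin (hX : IsCompact X) {x₀ : Fin n → ℝ} (hx₀ : x₀ ∈ X)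
    (hx₀K : ∀ i, x₀ ∈ K i) (hη : ∀ i, 0 < η i) (R : Finset ι) :
    ∃ z, IsRelaxedMin X K η c δ R z := by
  obtain ⟨z, hz, hmin⟩ := (isCompact_relaxed (K := K) (η := η) (R := R) hX).exists_isMinOn
    ⟨x₀, hx₀, fun i _ => by rw [infDist_zero_of_mem (hx₀K i)]; exact (hη i).le⟩
    (continuous_regObj (c := c) (δ := δ)).continuousOn
  exact ⟨z, hz, fun y hy => hmin hy⟩

/-- The lower end is the set of active constraints, which alone determines the minimizer. Genericity
says that no constraint outside `R` is active at `z R`; it yields both the size bound and the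
stability of active sets. -/
lemma isIntervalPartition_of_generic [Fintype ι] [DecidableEq ι] (hX : Convex ℝ X)
    (hK : ∀ i, Convex ℝ (K i)) {x₀ : Fin n → ℝ} (hx₀ : x₀ ∈ X) (hx₀K : ∀ i, x₀ ∈ K i)
    (hη : ∀ i, 0 < η i) (hδ : 0 < δ)
    {z : Finset ι → Fin n → ℝ} (hz : ∀ R, IsRelaxedMin X K η c δ R (z R))
    (hgen : ∀ R, ∀ j ∉ R, infDist (z R) (K j) ≠ η j) :
    IsIntervalPartition (fun R : Finset ι => R.filter fun j => infDist (z R) (K j) = η j)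
      (fun R => Finset.univ.filter fun j => η j < infDist (z R) (K j)) ∧
    ∀ R : Finset ι, (R.filter fun j => infDist (z R) (K j) = η j).card ≤ n := by
  have hne : ∀ i, (K i).Nonempty := fun i => ⟨x₀, hx₀K i⟩
  have huniq : ∀ R y, y ∈ relaxed X K η R → regObj c δ y ≤ regObj c δ (z R) → y = z R :=
    fun R y hy hle => eq_of_regObj_le hδ (convex_relaxed hX hK hne hη) (hz R).1 (hz R).2 hy hle
  set A : Finset ι → Finset ι := fun R => R.filter fun j => infDist (z R) (K j) = η j with hAdef
  -- If the active constraints alone allowed a smaller value, a short step from `z R` towards that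
  -- point would keep the inactive constraints satisfied and decrease the objective.
  have hAz : ∀ R, z (A R) = z R := by
    intro R
    symm
    refine huniq (A R) (z R) ⟨(hz R).1.1, fun i hi => (hz R).1.2 i (Finset.mem_filter.1 hi).1⟩ ?_
    by_contra! hlt
    set y := z (A R)
    have hcont : ∀ i, Continuous fun t : ℝ => infDist (z R + t • (y - z R)) (K i) := fun i =>
      (continuous_infDist_pt _).comp (by fun_prop)
    have hev : ∀ᶠ t in nhdsWithin (0 : ℝ) (Ioi 0), z R + t • (y - z R) ∈ relaxed X K η R := by
      have h1 : ∀ᶠ t in nhdsWithin (0 : ℝ) (Ioi 0), t ∈ Ioo (0 : ℝ) 1 :=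
        Ioo_mem_nhdsGT one_pos
      have h2 : ∀ᶠ t in nhdsWithin (0 : ℝ) (Ioi 0), ∀ i ∈ R \ A R,
          infDist (z R + t • (y - z R)) (K i) < η i := by
        rw [Filter.eventually_all_finset]
        intro i hi
        have hlti : infDist (z R) (K i) < η i := by
          simp only [hAdef, Finset.mem_sdiff, Finset.mem_filter, not_and] at hi
          exact lt_of_le_of_ne ((hz R).1.2 i hi.1) (hi.2 hi.1)
        refine ((hcont i).tendsto 0).eventually_lt_const (by simpa using hlti) |>.filter_mono
          nhdsWithin_le_nhds
      filter_upwards [h1, h2] with t ht ht2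
      have e : z R + t • (y - z R) = (1 - t) • z R + t • y := by module
      refine ⟨?_, fun i hi => ?_⟩
      · rw [e]
        exact hX (hz R).1.1 (hz (A R)).1.1 (by linarith [ht.2]) ht.1.le (by ring)
      · by_cases hiA : i ∈ A R
        · have := convex_infDist_le (hK i) (hne i) (hη i).le ((hz R).1.2 i hi)
            ((hz (A R)).1.2 i hiA) (show 0 ≤ 1 - t by linarith [ht.2]) ht.1.le (by ring)
          rw [e]; exact this
        · exact (ht2 i (Finset.mem_sdiff.2 ⟨hi, hiA⟩)).le
    obtain ⟨t, ht, ht1⟩ := (hev.and (Ioo_mem_nhdsGT one_pos : ∀ᶠ t in _, t ∈ Ioo (0 : ℝ) 1)).exists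
    have h1 := (hz R).2 _ ht
    have h2 := regObj_combo_le (c := c) hδ.le (z R) y ht1.1.le ht1.2.le
    nlinarith [ht1.1]
  -- By Helly, `n` active constraints would already determine `z R`; any further active one would
  -- then be active at `z I` without belonging to `I`.
  have hAcard : ∀ R, (A R).card ≤ n := by
    intro R
    by_contra! hcard
    obtain ⟨I, hIA, hIn, w, hw, hwle⟩ := exists_subfamily_optimal
      (K := fun i => X ∩ {x | infDist x (K i) ≤ η i}) (S := A R) (k := n)
      (fun i _ => hX.inter (convex_infDist_le (hK i) (hne i) (hη i).le))
      (convex_regObj_le (c := c) hδ.le)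
      (x₀ := x₀) (fun i _ => ⟨hx₀, by
        rw [mem_ofPred_eq, infDist_zero_of_mem (hx₀K i)]; exact (hη i).le⟩)
      le_rfl hcard.le (y := z) (fun I _ _ i hi => ⟨(hz I).1.1, (hz I).1.2 i hi⟩)
    obtain ⟨j, hjA, hjI⟩ := Finset.exists_mem_notMem_of_card_lt_card (hIn.trans_lt hcard)
    have hwX : w ∈ X := (hw j hjA).1
    have h1 : w = z I := huniq I w ⟨hwX, fun i hi => (hw i (hIA hi)).2⟩ hwle
    have h2 : z R = z I := by
      refine huniq I (z R) ⟨(hz R).1.1, fun i hi => (hz R).1.2 i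
        (Finset.mem_filter.1 (hIA hi)).1⟩ ?_
      rw [← hAz R, ← h1]
      exact (hz (A R)).2 w ⟨hwX, fun i hi => (hw i hi).2⟩
    refine hgen I j hjI ?_
    rw [← h2]
    exact (Finset.mem_filter.1 hjA).2
  refine ⟨⟨fun R => Finset.filter_subset _ _, fun R => ?_, fun R T hAT hVT => ?_⟩, hAcard⟩
  · rw [Finset.disjoint_left]
    intro i hi hiR
    exact absurd ((hz R).1.2 i hiR) (not_le.2 (Finset.mem_filter.1 hi).2)
  · have hzT : z R = z T := by
      refine huniq T (z R) ⟨(hz R).1.1, fun i hi => ?_⟩ ?_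
      · by_contra! hlt
        exact Finset.disjoint_left.1 hVT (by simpa using hlt) hi
      · rw [← hAz R]
        exact (hz (A R)).2 _ ⟨(hz T).1.1, fun i hi => (hz T).1.2 i (hAT hi)⟩
    refine ⟨?_, by rw [hzT]⟩
    apply Finset.Subset.antisymm
    · intro j hj
      rw [Finset.mem_filter, ← hzT] at hj
      by_contra hjA
      refine hgen (A R) j hjA ?_
      rw [hAz R]
      exact hj.2
    · intro j hj
      rw [Finset.mem_filter, ← hzT]
      exact ⟨hAT hj, (Finset.mem_filter.1 hj).2⟩

/-- Choose the coordinates from a grid of `L` values, with `L` exceeding the number of pairs (R, j).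
For j ∉ R the value `g η R j` does not depend on `η j`, so the other coordinates leave at most one
bad choice of `η j`. Each pair spoils at most a fraction 1/L of the grid. -/
lemma exists_generic [Fintype ι] [DecidableEq ι] {g : (ι → ℝ) → Finset ι → ι → ℝ}
    (hg : ∀ η η' : ι → ℝ, ∀ R j, (∀ i ∈ R, η i = η' i) → g η R j = g η' R j)
    {δ : ℝ} (hδ : 0 < δ) :
    ∃ η : ι → ℝ, (∀ i, 0 < η i) ∧ (∀ i, η i ≤ δ) ∧ ∀ R, ∀ j ∉ R, g η R j ≠ η j := by
  set L := Fintype.card (Finset ι × ι) + 1 with hL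
  have hLpos : (0 : ℝ) < L := by rw [hL]; positivity
  let v : (ι → Fin L) → ι → ℝ := fun s i => δ * ((s i : ℝ) + 1) / L
  have hinj : ∀ s s' : ι → Fin L, ∀ j, v s j = v s' j → s j = s' j := by
    intro s s' j h
    have h1 : δ * ((s j : ℝ) + 1) / L = δ * ((s' j : ℝ) + 1) / L := h
    rw [div_left_inj' hLpos.ne'] at h1
    have h2 := mul_left_cancel₀ hδ.ne' h1
    exact Fin.ext (by exact_mod_cast add_right_cancel h2)
  let bad : Finset ι × ι → Finset (ι → Fin L) := fun p =>
    Finset.univ.filter fun s => p.2 ∉ p.1 ∧ g (v s) p.1 p.2 = v s p.2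
  have hbad : ∀ p, (bad p).card * L ≤ L ^ Fintype.card ι := by
    rintro ⟨R, j⟩
    have h1 : (bad (R, j)).card ≤ Fintype.card ({i // i ≠ j} → Fin L) := by
      rw [← Finset.card_univ]
      refine Finset.card_le_card_of_injOn (fun s i => s i) (by simp) ?_
      intro s hs s' hs' h
      simp only [bad, Finset.coe_filter, Finset.mem_univ, true_and, mem_ofPred_eq] at hs hs'
      have hoff : ∀ i ≠ j, s i = s' i := fun i hi => congrFun h ⟨i, hi⟩
      have hj : v s j = v s' j := by
        rw [← hs.2, ← hs'.2]
        refine hg _ _ _ _ fun i hi => ?_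
        have : i ≠ j := fun e => hs.1 (e ▸ hi)
        simp only [v, hoff i this]
      funext i
      by_cases hi : i = j
      · subst hi; exact hinj _ _ _ hj
      · exact hoff i hi
    rw [Fintype.card_fun, Fintype.card_fin, Fintype.card_subtype_compl, Fintype.card_subtype_eq]
      at h1
    have hpos : 0 < Fintype.card ι := Fintype.card_pos_iff.2 ⟨j⟩
    calc (bad (R, j)).card * L ≤ L ^ (Fintype.card ι - 1) * L := Nat.mul_le_mul_right _ h1
      _ = L ^ Fintype.card ι := by rw [← pow_succ, Nat.sub_add_cancel hpos]
  have hlt : (Finset.univ.biUnion bad).card < L ^ Fintype.card ι := by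
    refine lt_of_le_of_lt Finset.card_biUnion_le ?_
    have h1 : (∑ p, (bad p).card) * L ≤ Fintype.card (Finset ι × ι) * L ^ Fintype.card ι := by
      rw [Finset.sum_mul]
      refine (Finset.sum_le_card_nsmul _ _ _ fun p _ => hbad p).trans ?_
      rw [Finset.card_univ, smul_eq_mul]
    have h2 : Fintype.card (Finset ι × ι) * L ^ Fintype.card ι < L * L ^ Fintype.card ι :=
      Nat.mul_lt_mul_of_pos_right (by omega) (by positivity)
    exact lt_of_mul_lt_mul_right (h1.trans_lt (h2.trans_eq (mul_comm _ _))) (Nat.zero_le L)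
  obtain ⟨s, -, hs⟩ := Finset.exists_mem_notMem_of_card_lt_card (s := Finset.univ.biUnion bad)
    (t := (Finset.univ : Finset (ι → Fin L))) (by
      rwa [Finset.card_univ, Fintype.card_fun, Fintype.card_fin])
  refine ⟨v s, fun i => by simp only [v]; positivity, fun i => ?_, fun R j hj h => ?_⟩
  · have : ((s i : ℕ) : ℝ) + 1 ≤ L := by exact_mod_cast (s i).2
    simp only [v]
    rw [div_le_iff₀ hLpos]
    exact mul_le_mul_of_nonneg_left this hδ.le
  · exact hs (Finset.mem_biUnion.2 ⟨(R, j), Finset.mem_univ _, by simp [bad, hj, h]⟩)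

/-- A violation of the original program persists under small perturbations. -/
lemma eventually_violated (hX : IsCompact X) (hKc : ∀ i, IsClosed (K i))
    (hne : ∀ i, (K i).Nonempty) {x : Fin n → ℝ} (hxX : x ∈ X) (hxK : ∀ i ∈ R, x ∈ K i)
    (huniq : ∀ y ∈ X, (∀ i ∈ R, y ∈ K i) → c ⬝ᵥ y ≤ c ⬝ᵥ x → y = x) {j : ι} (hj : x ∉ K j) :
    ∀ᶠ k : ℕ in Filter.atTop, ∀ η : ι → ℝ, (∀ i, 0 < η i) → (∀ i, η i ≤ 1 / ((k : ℝ) + 1)) →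
      ∀ z, IsRelaxedMin X K η c (1 / ((k : ℝ) + 1)) R z → η j < infDist z (K j) := by
  -- Otherwise perturbed minimizers satisfying constraint `j` up to the tolerance accumulate at some
  -- `w`. It is feasible with value at most that of `x`, hence equals `x` by uniqueness, yet lies in
  -- `K j`.
  by_contra hcon
  rw [Filter.not_eventually] at hcon
  obtain ⟨u, hu, hcon⟩ := Filter.extraction_of_frequently_atTop hcon
  push Not at hcon
  choose η hη0 hη1 z hz hzj using hcon
  obtain ⟨w, hwX, v, hv, hlim⟩ := hX.tendsto_subseq fun k => (hz k).1.1
  have ht : Filter.Tendsto (fun k => 1 / ((u (v k) : ℕ) + 1 : ℝ)) Filter.atTop (nhds 0) :=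
    (tendsto_one_div_add_atTop_nhds_zero_nat (𝕜 := ℝ)).comp
      (hu.comp hv).tendsto_atTop
  have hmem : ∀ i, (∀ k, infDist (z k) (K i) ≤ η k i) → w ∈ K i := by
    intro i hi
    rw [(hKc i).mem_iff_infDist_zero (hne i)]
    refine le_antisymm ?_ infDist_nonneg
    refine le_of_tendsto_of_tendsto' (((continuous_infDist_pt (K i)).tendsto w).comp hlim) ht
      fun k => (hi (v k)).trans (hη1 (v k) i)
  have hwx : w = x := by
    refine huniq w hwX (fun i hi => hmem i fun k => (hz k).1.2 i hi) ?_
    have hc : Continuous fun y : Fin n → ℝ => c ⬝ᵥ y := by unfold dotProduct; fun_prop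
    have ht2 : Filter.Tendsto (fun k => c ⬝ᵥ x + 1 / ((u (v k) : ℕ) + 1 : ℝ) * ∑ i, x i ^ 2)
        Filter.atTop (nhds (c ⬝ᵥ x + 0 * ∑ i, x i ^ 2)) :=
      tendsto_const_nhds.add (ht.mul_const _)
    rw [zero_mul, add_zero] at ht2
    refine le_of_tendsto_of_tendsto' ((hc.tendsto w).comp hlim) ht2 fun k => ?_
    have h1 := (hz (v k)).2 x ⟨hxX, fun i hi => by
      rw [infDist_zero_of_mem (hxK i hi)]; exact (hη0 (v k) i).le⟩
    have h2 : 0 ≤ 1 / ((u (v k) : ℕ) + 1 : ℝ) * ∑ i, z (v k) i ^ 2 := by positivity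
    simp only [regObj] at h1
    simp only [Function.comp_apply]
    linarith
  exact hj (hwx ▸ hmem j hzj)

end Perturbed

/-! ### The finite counting bound for convex programs -/

/-- Finite tail bound for the violations of convex scenario programs with compact constraints. -/
lemma card_violations_le_of_compact {n M N : ℕ} {X : Set (Fin n → ℝ)} (hX : IsCompact X)
    (hXc : Convex ℝ X) (c : Fin n → ℝ) {K : Fin M → Set (Fin n → ℝ)}
    (hKc : ∀ i, IsClosed (K i)) (hK : ∀ i, Convex ℝ (K i)) {x₀ : Fin n → ℝ} (hx₀ : x₀ ∈ X)
    (hx₀K : ∀ i, x₀ ∈ K i) (hnN : n ≤ N) {x : Finset (Fin M) → Fin n → ℝ}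
    (hx : ∀ R, R.card = N → x R ∈ X ∧ (∀ i ∈ R, x R ∈ K i) ∧
      ∀ y ∈ X, (∀ i ∈ R, y ∈ K i) → c ⬝ᵥ y ≤ c ⬝ᵥ x R → y = x R)
    {W : Finset (Fin M) → Finset (Fin M)} (hW : ∀ R, R.card = N → ∀ j ∈ W R, x R ∉ K j)
    (k : ℕ) :
    ((Finset.powersetCard N Finset.univ).filter (fun R => k < (W R).card)).card
      ≤ ((Finset.powersetCard N Finset.univ).filter (fun R : Finset (Fin M) =>
          (R.filter (fun j : Fin M => (j : ℕ) < k + n)).card < n)).card := by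
  have hne : ∀ i, (K i).Nonempty := fun i => ⟨x₀, hx₀K i⟩
  have hev : ∀ᶠ l : ℕ in Filter.atTop, ∀ R : Finset (Fin M), ∀ j, R.card = N → j ∈ W R →
      ∀ η : Fin M → ℝ, (∀ i, 0 < η i) → (∀ i, η i ≤ 1 / ((l : ℝ) + 1)) →
      ∀ z, IsRelaxedMin X K η c (1 / ((l : ℝ) + 1)) R z → η j < Metric.infDist z (K j) := by
    rw [Filter.eventually_all]
    intro R
    rw [Filter.eventually_all]
    intro j
    by_cases hR : R.card = N ∧ j ∈ W R
    · filter_upwards [eventually_violated hX hKc hne (hx R hR.1).1 (hx R hR.1).2.1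
        (hx R hR.1).2.2 (hW R hR.1 j hR.2)] with l hl _ _
      exact hl
    · exact Filter.Eventually.of_forall fun l h1 h2 => absurd ⟨h1, h2⟩ hR
  obtain ⟨l, hl⟩ := hev.exists
  set δ : ℝ := 1 / ((l : ℝ) + 1) with hδdef
  have hδ : 0 < δ := by positivity
  classical
  -- The minimizer is chosen from the predicate itself, so it depends on `η` only through the
  -- coordinates in `R`, as `exists_generic` requires.
  let z : (Fin M → ℝ) → Finset (Fin M) → Fin n → ℝ := fun η R =>
    if h : ∃ z, IsRelaxedMin X K η c δ R z then h.choose else 0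
  have hcongr : ∀ η η' : Fin M → ℝ, ∀ R, (∀ i ∈ R, η i = η' i) → z η R = z η' R := by
    intro η η' R h
    have hrel : relaxed X K η R = relaxed X K η' R := by
      ext y
      simp only [relaxed, mem_ofPred_eq]
      refine and_congr_right fun _ => forall₂_congr fun i hi => by rw [h i hi]
    have hP : IsRelaxedMin X K η c δ R = IsRelaxedMin X K η' c δ R := by
      funext y; simp only [IsRelaxedMin, hrel]
    simp only [z, hP]
  obtain ⟨η, hη0, hη1, hgen⟩ := exists_generic
    (g := fun η R j => Metric.infDist (z η R) (K j))
    (fun η η' R j h => by simp only [hcongr η η' R h]) hδ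
  have hz : ∀ R, IsRelaxedMin X K η c δ R (z η R) := by
    intro R
    have h := exists_isRelaxedMin (c := c) (δ := δ) hX hx₀ hx₀K hη0 R
    simp only [z, dif_pos h]
    exact h.choose_spec
  obtain ⟨hpart, hcard⟩ := isIntervalPartition_of_generic hXc hK hx₀ hx₀K hη0 hδ hz hgen
  refine le_trans (Finset.card_le_card fun R hR => ?_) (hpart.card_violated_tail_le hcard hnN k)
  simp only [Finset.mem_filter, Finset.mem_powersetCard, Finset.subset_univ, true_and] at hR ⊢
  refine ⟨hR.1, hR.2.trans_le (Finset.card_le_card fun j hj => ?_)⟩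
  simp only [Finset.mem_filter, Finset.mem_univ, true_and]
  exact hl R j hR.1 hj η hη0 hη1 _ (hz R)

/-- Finite tail bound for the violations of convex scenario programs. -/
theorem card_violations_le {n M N : ℕ} {X : Set (Fin n → ℝ)} (hX : IsCompact X)
    (hXc : Convex ℝ X) (c : Fin n → ℝ) {C : Fin M → Set (Fin n → ℝ)}
    (hC : ∀ i, Convex ℝ (C i)) {x₀ : Fin n → ℝ} (hx₀ : x₀ ∈ X)
    (hx₀C : ∀ i, x₀ ∈ C i) (hnN : n ≤ N) {x : Finset (Fin M) → Fin n → ℝ}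
    (hx : ∀ R, R.card = N → x R ∈ X ∧ (∀ i ∈ R, x R ∈ C i) ∧
      ∀ y ∈ X, (∀ i ∈ R, y ∈ C i) → c ⬝ᵥ y ≤ c ⬝ᵥ x R → y = x R)
    {W : Finset (Fin M) → Finset (Fin M)} (hW : ∀ R, R.card = N → ∀ j ∈ W R, x R ∉ C j)
    (k : ℕ) :
    ((Finset.powersetCard N Finset.univ).filter (fun R => k < (W R).card)).card
      ≤ ((Finset.powersetCard N Finset.univ).filter (fun R : Finset (Fin M) =>
          (R.filter (fun j : Fin M => (j : ℕ) < k + n)).card < n)).card := by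
  -- The sets `C j` need not be closed. The hull of `x₀` and the finitely many optimizers in `C j`
  -- is compact and lies in `C j`, so the optimizers stay unique and violated constraints stay
  -- violated.
  let G : Fin M → Set (Fin n → ℝ) := fun j => insert x₀ {y | ∃ R, R.card = N ∧ y = x R ∧ y ∈ C j}
  have hGfin : ∀ j, (G j).Finite := fun j =>
    ((Set.finite_range x).subset (by rintro _ ⟨R, -, rfl, -⟩; exact ⟨R, rfl⟩)).insert _
  have hsub : ∀ j, convexHull ℝ (G j) ⊆ C j := fun j =>
    convexHull_min (insert_subset (hx₀C j) fun y hy => by obtain ⟨_, _, _, h⟩ := hy; exact h) (hC j)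
  refine card_violations_le_of_compact hX hXc c (K := fun j => convexHull ℝ (G j))
    (fun j => ((hGfin j).isCompact_convexHull (𝕜 := ℝ)).isClosed) (fun j => convex_convexHull _ _) hx₀
    (fun j => subset_convexHull _ _ (mem_insert _ _)) hnN (x := x) (fun R hR => ?_)
    (fun R hR j hj h => hW R hR j hj (hsub j h)) k
  obtain ⟨h1, h2, h3⟩ := hx R hR
  exact ⟨h1, fun i hi => subset_convexHull _ _ (mem_insert_of_mem _ ⟨R, hR, rfl, h2 i hi⟩),
    fun y hy hyK hle => h3 y hy (fun i hi => hsub i (hyK i hi)) hle⟩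

/-! ### Countable approximation by strictly feasible points -/

section Dense

open Filter Topology

/-- Pushing `x₀` slightly into the interior keeps strict feasibility; pushing `x` slightly towards
the result gives a strictly feasible interior point near `x`. Convex functions are continuous there,
so a fixed dense sequence serves every family. -/
lemma exists_countable_approx_of_interior {E : Type*} [NormedAddCommGroup E] [NormedSpace ℝ E]
    [FiniteDimensional ℝ E] {X : Set E} (hX : Convex ℝ X) (hint : (interior X).Nonempty) :
    ∃ Q : Set E, Q.Countable ∧ Q ⊆ X ∧ ∀ (ι : Type) [Finite ι] (g : ι → E → ℝ),
      (∀ i, ConvexOn ℝ X (g i)) → ∀ x₀ ∈ X, (∀ i, g i x₀ < 0) → ∀ x ∈ X, (∀ i, g i x ≤ 0) →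
        ∀ U ∈ 𝓝 x, ∃ q ∈ Q, q ∈ U ∧ ∀ i, g i q < 0 := by
  have : ProperSpace E := FiniteDimensional.proper ℝ E
  refine ⟨range (TopologicalSpace.denseSeq E) ∩ interior X,
    (countable_range _).mono inter_subset_left, inter_subset_right.trans interior_subset, ?_⟩
  intro ι _ g hg x₀ hx₀ hgx₀ x hx hgx U hU
  obtain ⟨z₀, hz₀⟩ := hint
  have hz₀X := interior_subset hz₀
  have h1 : ∀ᶠ t in 𝓝[>] (0 : ℝ), ∀ i, g i ((1 - t) • x₀ + t • z₀) < 0 := by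
    rw [eventually_all]
    intro i
    have hc : Continuous fun t : ℝ => (1 - t) * g i x₀ + t * g i z₀ := by fun_prop
    have h2 : ∀ᶠ t in 𝓝[>] (0 : ℝ), (1 - t) * g i x₀ + t * g i z₀ < 0 :=
      ((hc.tendsto 0).eventually_lt_const (by simpa using hgx₀ i)).filter_mono nhdsWithin_le_nhds
    filter_upwards [h2, Ioo_mem_nhdsGT (one_pos : (0 : ℝ) < 1)] with t ht ht1
    refine ((hg i).2 hx₀ hz₀X (by linarith [ht1.2]) ht1.1.le (by ring)).trans_lt ?_
    simpa using ht
  obtain ⟨t, ht, ht1⟩ := (h1.and (Ioo_mem_nhdsGT (one_pos : (0 : ℝ) < 1))).exists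
  set z := (1 - t) • x₀ + t • z₀ with hz
  have hzint : z ∈ interior X :=
    hX.combo_self_interior_mem_interior hx₀ hz₀ (by linarith [ht1.2]) ht1.1 (by ring)
  have hcont : Continuous fun s : ℝ => (1 - s) • x + s • z := by fun_prop
  have hUU : ∀ᶠ y in 𝓝 ((1 - (0 : ℝ)) • x + (0 : ℝ) • z), U ∈ 𝓝 y := by
    simpa using eventually_mem_nhds_iff.2 hU
  obtain ⟨s, hsU, hs⟩ := ((((hcont.tendsto 0).eventually hUU).filter_mono
    nhdsWithin_le_nhds).and (Ioo_mem_nhdsGT (one_pos : (0 : ℝ) < 1))).exists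
  set y := (1 - s) • x + s • z with hy
  have hyint : y ∈ interior X :=
    hX.combo_self_interior_mem_interior hx hzint (by linarith [hs.2]) hs.1 (by ring)
  have hgy : ∀ i, g i y < 0 := by
    intro i
    refine ((hg i).2 hx (interior_subset hzint) (by linarith [hs.2]) hs.1.le
      (by ring)).trans_lt ?_
    have := mul_neg_of_pos_of_neg hs.1 (ht i)
    have := mul_nonpos_of_nonneg_of_nonpos (by linarith [hs.2] : 0 ≤ 1 - s) (hgx i)
    simp only [smul_eq_mul]
    linarith
  have hnear : ∀ᶠ w in 𝓝 y, w ∈ U ∧ w ∈ interior X ∧ ∀ i, g i w < 0 := by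
    refine Filter.Eventually.and hsU (Filter.Eventually.and
      (isOpen_interior.mem_nhds hyint) ?_)
    rw [eventually_all]
    intro i
    exact (((hg i).continuousOn_interior).continuousAt
      (isOpen_interior.mem_nhds hyint)).eventually_lt_const (hgy i)
  obtain ⟨k, hkU, hkX, hkg⟩ := (TopologicalSpace.denseRange_denseSeq E).mem_nhds hnear
  exact ⟨_, ⟨mem_range_self k, hkX⟩, hkU, hkg⟩

/-- Parametrizing the affine span by its direction gives the convex set nonempty interior. -/
lemma exists_countable_approx {E : Type*} [NormedAddCommGroup E] [NormedSpace ℝ E]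
    [FiniteDimensional ℝ E] {X : Set E} (hX : Convex ℝ X) :
    ∃ Q : Set E, Q.Countable ∧ Q ⊆ X ∧ ∀ (ι : Type) [Finite ι] (g : ι → E → ℝ),
      (∀ i, ConvexOn ℝ X (g i)) → ∀ x₀ ∈ X, (∀ i, g i x₀ < 0) → ∀ x ∈ X, (∀ i, g i x ≤ 0) →
        ∀ U ∈ 𝓝 x, ∃ q ∈ Q, q ∈ U ∧ ∀ i, g i q < 0 := by
  rcases X.eq_empty_or_nonempty with rfl | ⟨p, hp⟩
  · exact ⟨∅, countable_empty, subset_rfl, fun _ _ _ _ x₀ hx₀ => absurd hx₀ (notMem_empty _)⟩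
  let L := (affineSpan ℝ X).direction
  let a : L →ᵃ[ℝ] E := L.subtype.toAffineMap + AffineMap.const ℝ L p
  have ha : ∀ v : L, a v = v + p := fun v => rfl
  have hpa : p ∈ affineSpan ℝ X := subset_affineSpan ℝ X hp
  have hlift : ∀ x ∈ affineSpan ℝ X, ∃ v : L, a v = x := fun x hx =>
    ⟨⟨x - p, AffineSubspace.vsub_mem_direction hx hpa⟩, by simp [ha]⟩
  have hY : Convex ℝ (a ⁻¹' X) := hX.affine_preimage a
  have himage : a '' (a ⁻¹' X) = X := by
    rw [image_preimage_eq_iff]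
    intro x hx
    exact hlift x (subset_affineSpan ℝ X hx)
  have hint : (interior (a ⁻¹' X)).Nonempty := by
    rw [hY.interior_nonempty_iff_affineSpan_eq_top, eq_top_iff]
    intro v _
    have h1 : a v ∈ affineSpan ℝ X :=
      AffineSubspace.vadd_mem_of_mem_direction v.2 hpa
    rw [← himage, ← AffineSubspace.map_span] at h1
    obtain ⟨v', hv', he⟩ := h1
    have : v' = v := by
      rw [ha, ha] at he
      exact Subtype.ext (add_right_cancel he)
    exact this ▸ hv'
  obtain ⟨Q, hQc, hQX, hQ⟩ := exists_countable_approx_of_interior hY hint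
  refine ⟨a '' Q, hQc.image _, by rintro _ ⟨q, hq, rfl⟩; exact hQX hq, ?_⟩
  intro ι _ g hg x₀ hx₀ hgx₀ x hx hgx U hU
  obtain ⟨v₀, rfl⟩ := hlift x₀ (subset_affineSpan ℝ X hx₀)
  obtain ⟨v, rfl⟩ := hlift x (subset_affineSpan ℝ X hx)
  have hac : Continuous a := by
    have : (a : L → E) = fun v : L => (v : E) + p := funext ha
    rw [this]; fun_prop
  obtain ⟨q, hq, hqU, hgq⟩ := hQ ι (fun i => g i ∘ a) (fun i => (hg i).comp_affineMap a) v₀ hx₀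
    hgx₀ v hx hgx (a ⁻¹' U) (hac.continuousAt hU)
  exact ⟨a q, mem_image_of_mem _ hq, hqU, hgq⟩

end Dense

/-! ### Measurability of the violation event -/

section Measurability

variable {n : ℕ} {D : Type*} [MeasurableSpace D] {X : Set (Fin n → ℝ)} {c : Fin n → ℝ}
  {f : (Fin n → ℝ) → D → ℝ}

lemma measurableSet_exists_feasible_lt (hX : Convex ℝ X) (hfm : ∀ x ∈ X, Measurable (f x))
    (hfc : ∀ d, ConvexOn ℝ X (fun x => f x d)) {x₀ : Fin n → ℝ} (hx₀ : x₀ ∈ X)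
    (hneg : ∀ d, f x₀ d < 0) {ι : Type} [Finite ι] {Ω : Type*} [MeasurableSpace Ω]
    {u : ι → Ω → D} (hu : ∀ i, Measurable (u i)) (r : ℝ) :
    MeasurableSet {ω | ∃ x ∈ X, (∀ i, f x (u i ω) ≤ 0) ∧ c ⬝ᵥ x < r} := by
  obtain ⟨Q, hQc, hQX, hQ⟩ := exists_countable_approx hX
  have heq : {ω | ∃ x ∈ X, (∀ i, f x (u i ω) ≤ 0) ∧ c ⬝ᵥ x < r}
      = ⋃ q ∈ Q ∩ {q | c ⬝ᵥ q < r}, ⋂ i, {ω | f q (u i ω) < 0} := by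
    ext ω
    simp only [mem_ofPred_eq, mem_iUnion, mem_iInter, exists_prop, mem_inter_iff]
    constructor
    · rintro ⟨x, hx, hfx, hcx⟩
      have hc : Continuous fun y : Fin n → ℝ => c ⬝ᵥ y := by unfold dotProduct; fun_prop
      obtain ⟨q, hq, hqr, hfq⟩ := hQ ι (fun i x => f x (u i ω)) (fun i => hfc _) x₀ hx₀
        (fun i => hneg _) x hx hfx _ (hc.continuousAt.eventually_lt_const hcx)
      exact ⟨q, ⟨hq, hqr⟩, hfq⟩
    · rintro ⟨q, ⟨hq, hqr⟩, hfq⟩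
      exact ⟨q, hQX hq, fun i => (hfq i).le, hqr⟩
  rw [heq]
  refine MeasurableSet.biUnion (hQc.mono inter_subset_left) fun q hq => ?_
  exact MeasurableSet.iInter fun i =>
    measurableSet_lt ((hfm q (hQX hq.1)).comp (hu i)) measurable_const

lemma IsUniqueMinimizer.le {S : Set (Fin n → ℝ)} {x y : Fin n → ℝ}
    (h : IsUniqueMinimizer c S x) (hy : y ∈ S) : c ⬝ᵥ x ≤ c ⬝ᵥ y := by
  by_contra! hlt
  rw [h.2 y hy hlt.le] at hlt
  exact lt_irrefl _ hlt

/-- The new sample is violated exactly when adding its constraint strictly raises the optimal value,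
which rational thresholds detect. This gives measurability for the product σ-algebra through optimal
values alone. -/
lemma measurableSet_violation (hX : Convex ℝ X) (hfm : ∀ x ∈ X, Measurable (f x))
    (hfc : ∀ d, ConvexOn ℝ X (fun x => f x d)) {x₀ : Fin n → ℝ} (hx₀ : x₀ ∈ X)
    (hneg : ∀ d, f x₀ d < 0) {N : ℕ} (hnN : n ≤ N) {xs : (Fin N → D) → Fin n → ℝ}
    (hxs : ∀ d, IsUniqueMinimizer c (scpFeasible X f d) (xs d)) :
    MeasurableSet {p : (Fin N → D) × D | 0 < f (xs p.1) p.2} := by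
  let u : Option (Fin N) → (Fin N → D) × D → D := fun o p => o.elim p.2 p.1
  have hu : ∀ o, Measurable (u o) := by
    intro o
    cases o with
    | none => exact measurable_snd
    | some i => exact (measurable_pi_apply i).comp measurable_fst
  have hA := fun r : ℚ => measurableSet_exists_feasible_lt (c := c) hX hfm hfc hx₀ hneg
    (fun i : Fin N => hu (some i)) r
  have hB := fun r : ℚ => measurableSet_exists_feasible_lt (c := c) hX hfm hfc hx₀ hneg hu r
  convert MeasurableSet.iUnion fun r : ℚ => (hA r).diff (hB r) using 1
  ext p
  simp only [mem_iUnion, mem_sdiff, mem_ofPred_eq]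
  constructor
  · intro hpos
    let ys : Finset (Option (Fin N)) → Fin n → ℝ := fun I =>
      if h : I.card = N then xs fun i => u ((I.equivFinOfCardEq h).symm i) p else x₀
    have hys : ∀ I : Finset (Option (Fin N)), I.card = N →
        IsUniqueMinimizer c {x | x ∈ X ∧ ∀ o ∈ I, f x (u o p) ≤ 0} (ys I) := by
      intro I h
      simp only [ys, dif_pos h]
      convert hxs _ using 1
      ext x
      simp only [scpFeasible, mem_ofPred_eq]
      refine and_congr_right fun _ => ⟨fun hx i => hx _ ((I.equivFinOfCardEq h).symm i).2,
        fun hx o ho => ?_⟩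
      simpa using hx (I.equivFinOfCardEq h ⟨o, ho⟩)
    -- Helly shows that the program with N + 1 constraints attains its optimum at `w`; without
    -- attainment the gap used below might not be strict.
    obtain ⟨I, -, hIN, w, hw, hwle⟩ := exists_subfamily_optimal (n := n)
      (K := fun o => {x | x ∈ X ∧ f x (u o p) ≤ 0}) (S := Finset.univ) (k := N)
      (φ := fun x => c ⬝ᵥ x)
      (fun o _ => (hfc (u o p)).convex_le 0) (fun r => by
        have : {x : Fin n → ℝ | c ⬝ᵥ x ≤ r} = {x | x ∈ univ ∧ c ⬝ᵥ x ≤ r} := by simp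
        rw [this]
        refine ConvexOn.convex_le (f := fun x => c ⬝ᵥ x) ⟨convex_univ, ?_⟩ r
        intro x _ y _ a b _ _ _
        simp [dotProduct_add, dotProduct_smul])
      (fun o _ => ⟨hx₀, (hneg _).le⟩) hnN
      (by simp) (y := ys) (fun I _ hI o ho => ⟨(hys I hI).1.1, (hys I hI).1.2 o ho⟩)
    have hwX : w ∈ X := (hw none (Finset.mem_univ _)).1
    have hlt : c ⬝ᵥ xs p.1 < c ⬝ᵥ w := by
      by_contra! hle
      have h1 := (hxs p.1).2 w ⟨hwX, fun i => (hw (some i) (Finset.mem_univ _)).2⟩ hle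
      have h2 : f w p.2 ≤ 0 := (hw none (Finset.mem_univ _)).2
      rw [h1] at h2
      exact absurd hpos (not_lt.2 h2)
    obtain ⟨r, hr1, hr2⟩ := exists_rat_btwn hlt
    refine ⟨r, ⟨xs p.1, (hxs p.1).1.1, (hxs p.1).1.2, hr1⟩, ?_⟩
    rintro ⟨y, hyX, hy, hyr⟩
    have := (hys I hIN).le (y := y) ⟨hyX, fun o _ => hy o⟩
    linarith
  · rintro ⟨r, ⟨x, hx, hfx, hxr⟩, hno⟩
    by_contra! hle
    refine hno ⟨xs p.1, (hxs p.1).1.1, fun o => ?_, ((hxs p.1).le ⟨hx, hfx⟩).trans_lt hxr⟩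
    cases o with
    | none => exact hle
    | some i => exact (hxs p.1).1.2 i

end Measurability

open Filter Topology

/-! ### From hypergeometric counts to the binomial tail -/

section Asymptotics

lemma tendsto_choose_div_pow {k : ℕ → ℕ} {a : ℝ}
    (h : Tendsto (fun m : ℕ => (k m : ℝ) / m) atTop (𝓝 a)) (i : ℕ) :
    Tendsto (fun m : ℕ => ((k m).choose i : ℝ) / (m : ℝ) ^ i) atTop
      (𝓝 (a ^ i / (i.factorial : ℝ))) := by
  induction i with
  | zero => simp
  | succ i ih =>
    have h1 : Tendsto (fun m : ℕ => (i : ℝ) / m) atTop (𝓝 0) :=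
      tendsto_const_div_atTop_nhds_zero_nat _
    have h2 := (ih.mul (h.sub h1)).div_const ((i : ℝ) + 1)
    have e : a ^ i / (i.factorial : ℝ) * (a - 0) / ((i : ℝ) + 1)
        = a ^ (i + 1) / ((i + 1).factorial : ℝ) := by
      rw [Nat.factorial_succ]
      push_cast
      have : (i.factorial : ℝ) ≠ 0 := by positivity
      field_simp
      ring
    rw [← e]
    refine h2.congr' ?_
    filter_upwards [eventually_gt_atTop 0] with m hm
    have hm' : (m : ℝ) ≠ 0 := by positivity
    have h3 : ((k m).choose (i + 1) : ℝ) * ((i : ℝ) + 1) = (k m).choose i * ((k m : ℝ) - i) := by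
      rcases le_or_gt i (k m) with hle | hlt
      · rw [← Nat.cast_sub hle]
        exact_mod_cast Nat.choose_succ_right_eq (k m) i
      · rw [Nat.choose_eq_zero_of_lt hlt, Nat.choose_eq_zero_of_lt (by omega)]
        simp
    have hi : (i : ℝ) + 1 ≠ 0 := by positivity
    field_simp
    linear_combination (-(m : ℝ) ^ (i + 1)) * h3

lemma card_powersetCard_filter {α : Type*} [Fintype α] [DecidableEq α] (p : α → Prop)
    [DecidablePred p] {N i : ℕ} (hi : i ≤ N) :
    ((Finset.powersetCard N (Finset.univ : Finset α)).filter
      (fun R => (R.filter p).card = i)).card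
      = (Finset.univ.filter p).card.choose i
        * (Finset.univ.filter fun x => ¬ p x).card.choose (N - i) := by
  rw [← Finset.card_powersetCard, ← Finset.card_powersetCard, ← Finset.card_product]
  have hU : ∀ T : Finset α × Finset α, T ∈ Finset.powersetCard i (Finset.univ.filter p) ×ˢ
      Finset.powersetCard (N - i) (Finset.univ.filter fun x => ¬ p x) →
      (T.1 ∪ T.2).filter p = T.1 ∧ (T.1 ∪ T.2).filter (fun x => ¬ p x) = T.2 := by
    rintro ⟨T, U⟩ h
    simp only [Finset.mem_product, Finset.mem_powersetCard] at h
    obtain ⟨⟨h1, -⟩, h2, -⟩ := h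
    constructor
    · ext x
      have := @h1 x; have := @h2 x
      simp only [Finset.mem_filter, Finset.mem_univ, true_and, Finset.mem_union] at *
      tauto
    · ext x
      have := @h1 x; have := @h2 x
      simp only [Finset.mem_filter, Finset.mem_univ, true_and, Finset.mem_union] at *
      tauto
  refine Finset.card_bij' (fun R _ => (R.filter p, R.filter fun x => ¬ p x))
    (fun T _ => T.1 ∪ T.2) ?_ ?_ ?_ ?_
  · intro R hR
    simp only [Finset.mem_filter, Finset.mem_powersetCard, Finset.subset_univ, true_and] at hR
    have := Finset.card_filter_add_card_filter_not (s := R) p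
    simp only [Finset.mem_product, Finset.mem_powersetCard]
    exact ⟨⟨Finset.filter_subset_filter _ (Finset.subset_univ _), hR.2⟩,
      Finset.filter_subset_filter _ (Finset.subset_univ _), by omega⟩
  · intro T hT
    obtain ⟨h1, h2⟩ := hU T hT
    have := Finset.card_filter_add_card_filter_not (s := T.1 ∪ T.2) p
    simp only [Finset.mem_product, Finset.mem_powersetCard] at hT
    rw [Finset.mem_filter, Finset.mem_powersetCard, h1]
    rw [h1, h2] at this
    exact ⟨⟨Finset.subset_univ _, by omega⟩, hT.1.2⟩
  · intro R _
    exact Finset.filter_union_filter_not_eq _ _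
  · intro T hT
    obtain ⟨h1, h2⟩ := hU T hT
    exact Prod.ext h1 h2

/-- The number of `N`-element sets meeting the first `K` elements in fewer than `n` points. -/
def lowCount (M N K n : ℕ) : ℕ :=
  ((Finset.powersetCard N Finset.univ).filter (fun R : Finset (Fin M) =>
    (R.filter (fun j : Fin M => (j : ℕ) < K)).card < n)).card

lemma lowCount_eq {M N K n : ℕ} (hK : K ≤ M) (hnN : n ≤ N) :
    lowCount M N K n = ∑ i ∈ Finset.range n, K.choose i * (M - K).choose (N - i) := by
  have hcard : (Finset.univ.filter (fun j : Fin M => (j : ℕ) < K)).card = K := by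
    rw [Fin.card_filter_val_lt]; omega
  have hcard' : (Finset.univ.filter (fun j : Fin M => ¬ (j : ℕ) < K)).card = M - K := by
    have := Finset.card_filter_add_card_filter_not (s := (Finset.univ : Finset (Fin M)))
      (fun j : Fin M => (j : ℕ) < K)
    rw [Finset.card_univ, Fintype.card_fin] at this
    omega
  rw [lowCount, Finset.card_eq_sum_card_fiberwise
    (f := fun R : Finset (Fin M) => (R.filter (fun j : Fin M => (j : ℕ) < K)).card)
    (t := Finset.range n)]
  · refine Finset.sum_congr rfl fun i hi => ?_
    rw [Finset.mem_range] at hi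
    rw [← hcard', ← congrArg (fun a => a.choose i) hcard, ← card_powersetCard_filter _ (by omega)]
    congr 1
    ext R
    simp only [Finset.mem_filter]
    constructor
    · rintro ⟨⟨h1, -⟩, h2⟩; exact ⟨h1, h2⟩
    · rintro ⟨h1, h2⟩; exact ⟨⟨h1, h2 ▸ hi⟩, h2⟩
  · intro R hR
    have := (Finset.mem_filter.1 hR).2
    simpa using this

/-- The binomial tail `∑_{i < n} (N choose i) ε^i (1 - ε)^(N - i)`. -/
def binomTail (n N : ℕ) (ε : ℝ) : ℝ :=
  ∑ i ∈ Finset.range n, (N.choose i : ℝ) * ε ^ i * (1 - ε) ^ (N - i)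

/-- The quotient is a hypergeometric tail with `N` draws in which the marked proportion tends to
`ε`. -/
lemma tendsto_lowCount_div {n N : ℕ} (hnN : n ≤ N) {ε : ℝ} (hε : ε ∈ Icc (0 : ℝ) 1) :
    Tendsto (fun m : ℕ => (lowCount (N + m) N (⌊ε * m⌋₊ + n) n : ℝ) / ((N + m).choose N : ℝ))
      atTop (𝓝 (binomTail n N ε)) := by
  have hfl : ∀ m : ℕ, ⌊ε * m⌋₊ ≤ m := fun m => Nat.floor_le_of_le (by
    have : (0 : ℝ) ≤ m := by positivity
    nlinarith [hε.2])
  have hconst : ∀ a : ℝ, Tendsto (fun m : ℕ => a / m) atTop (𝓝 0) := fun a =>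
    tendsto_const_div_atTop_nhds_zero_nat _
  have hself : Tendsto (fun m : ℕ => (m : ℝ) / m) atTop (𝓝 1) := by
    refine tendsto_const_nhds.congr' ?_
    filter_upwards [eventually_gt_atTop 0] with m hm
    rw [div_self (by positivity)]
  have hK : Tendsto (fun m : ℕ => ((⌊ε * m⌋₊ + n : ℕ) : ℝ) / m) atTop (𝓝 ε) := by
    have h1 := (tendsto_nat_floor_mul_div_atTop hε.1).comp (tendsto_natCast_atTop_atTop (R := ℝ))
    have h2 := h1.add (hconst n)
    rw [add_zero] at h2
    refine h2.congr fun m => ?_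
    simp only [Function.comp_apply]
    push_cast
    ring
  have hM : Tendsto (fun m : ℕ => ((N + m : ℕ) : ℝ) / m) atTop (𝓝 1) := by
    have h2 := (hconst N).add hself
    rw [zero_add] at h2
    refine h2.congr fun m => ?_
    push_cast
    ring
  have hMK : Tendsto (fun m : ℕ => ((N + m - (⌊ε * m⌋₊ + n) : ℕ) : ℝ) / m) atTop
      (𝓝 (1 - ε)) := by
    refine (hM.sub hK).congr fun m => ?_
    have := hfl m
    rw [Nat.cast_sub (by omega)]
    ring
  have hC := tendsto_choose_div_pow hM N
  rw [one_pow] at hC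
  have hterm : ∀ i ∈ Finset.range n, Tendsto (fun m : ℕ =>
      ((⌊ε * m⌋₊ + n).choose i : ℝ) * ((N + m - (⌊ε * m⌋₊ + n)).choose (N - i) : ℝ)
        / ((N + m).choose N : ℝ)) atTop (𝓝 ((N.choose i : ℝ) * ε ^ i * (1 - ε) ^ (N - i))) := by
    intro i hi
    have hiN : i ≤ N := by rw [Finset.mem_range] at hi; omega
    have h := ((tendsto_choose_div_pow hK i).mul (tendsto_choose_div_pow hMK (N - i))).div hC
      (by positivity)
    have e : ε ^ i / (i.factorial : ℝ) * ((1 - ε) ^ (N - i) / ((N - i).factorial : ℝ))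
        / (1 / (N.factorial : ℝ)) = (N.choose i : ℝ) * ε ^ i * (1 - ε) ^ (N - i) := by
      rw [Nat.cast_choose ℝ hiN]
      field_simp
    rw [e] at h
    refine h.congr' ?_
    filter_upwards [eventually_gt_atTop 0] with m hm
    have hm' : (m : ℝ) ≠ 0 := by positivity
    have hpow : (m : ℝ) ^ N = (m : ℝ) ^ i * (m : ℝ) ^ (N - i) := by
      rw [← pow_add]; congr 1; omega
    have hne : ((N + m).choose N : ℝ) ≠ 0 := by
      exact_mod_cast (Nat.choose_pos (by omega)).ne'
    simp only [Pi.div_apply]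
    rw [hpow]
    field_simp
  have hsum := tendsto_finsetSum (Finset.range n) hterm
  refine hsum.congr fun m => ?_
  have := hfl m
  rw [lowCount_eq (by omega) hnN]
  push_cast
  rw [Finset.sum_div]

/-- Conditioning on one extra trial writes the new tail as a convex combination of the old tails
with bounds n + 1 and `n`. -/
lemma binomTail_succ_le (n N : ℕ) {ε : ℝ} (hε : ε ∈ Icc (0 : ℝ) 1) :
    binomTail n (N + 1) ε ≤ binomTail n N ε := by
  have h0 := hε.1
  have h1 : 0 ≤ 1 - ε := by linarith [hε.2]
  cases n with
  | zero => simp [binomTail]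
  | succ n =>
    have hrec : binomTail (n + 1) (N + 1) ε
        = (1 - ε) * binomTail (n + 1) N ε + ε * binomTail n N ε := by
      have hA : ∀ i, (N.choose i : ℝ) * ε ^ i * (1 - ε) ^ (N + 1 - i)
          = (1 - ε) * ((N.choose i : ℝ) * ε ^ i * (1 - ε) ^ (N - i)) := by
        intro i
        rcases le_or_gt i N with hi | hi
        · rw [Nat.succ_sub hi, pow_succ]; ring
        · rw [Nat.choose_eq_zero_of_lt hi]; simp
      simp only [binomTail]
      rw [Finset.sum_range_succ' _ n, Finset.sum_range_succ' _ n, mul_add, Finset.mul_sum,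
        Finset.mul_sum, ← hA 0, Nat.choose_zero_right, Nat.choose_zero_right,
        add_right_comm, ← Finset.sum_add_distrib]
      congr 1
      refine Finset.sum_congr rfl fun i _ => ?_
      rw [← hA (i + 1), Nat.choose_succ_succ, Nat.succ_sub_succ]
      push_cast
      ring
    have hle : binomTail n N ε ≤ binomTail (n + 1) N ε := by
      simp only [binomTail]
      rw [Finset.sum_range_succ _ n]
      have : 0 ≤ (N.choose n : ℝ) * ε ^ n * (1 - ε) ^ (N - n) := by positivity
      linarith
    rw [hrec]
    nlinarith

lemma binomTail_antitone (n : ℕ) {ε : ℝ} (hε : ε ∈ Icc (0 : ℝ) 1) :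
    Antitone fun N => binomTail n N ε :=
  antitone_nat_of_succ_le fun N => binomTail_succ_le n N hε

lemma binomTail_of_lt {n N : ℕ} (h : N < n) (ε : ℝ) : binomTail n N ε = 1 := by
  have h1 : binomTail n N ε = binomTail (N + 1) N ε := by
    rw [binomTail, binomTail, ← Finset.sum_subset (Finset.range_subset_range.2 h)]
    intro i _ hi
    rw [Nat.choose_eq_zero_of_lt (by simpa using hi)]
    simp
  have h2 := add_pow ε (1 - ε) N
  rw [add_sub_cancel, one_pow] at h2
  rw [h1, h2, binomTail]
  refine Finset.sum_congr rfl fun i _ => ?_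
  ring

end Asymptotics

/-! ### Exchangeability and the law of large numbers -/

section Sampling

open ProbabilityTheory

variable {D : Type*}

open scoped Classical in
/-- The number of samples that lie in `A`. -/
noncomputable def hits {m : ℕ} (A : Set D) (b : Fin m → D) : ℕ :=
  (Finset.univ.filter fun j => b j ∈ A).card

lemma hits_eq_sum {m : ℕ} (A : Set D) (b : Fin m → D) :
    (hits A b : ℝ) = ∑ j, A.indicator (fun _ => (1 : ℝ)) (b j) := by
  classical
  simp [hits, indicator_apply, Finset.sum_boole]

variable [MeasurableSpace D]

lemma measurable_hits {m : ℕ} {Ω : Type*} [MeasurableSpace Ω] {S : Set (Ω × D)}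
    (hS : MeasurableSet S) :
    Measurable fun p : Ω × (Fin m → D) => hits {e | (p.1, e) ∈ S} p.2 := by
  classical
  simp only [hits, mem_ofPred_eq, Finset.card_filter]
  refine Finset.measurable_sum _ fun j _ => ?_
  refine Measurable.ite ?_ measurable_const measurable_const
  exact hS.preimage (measurable_fst.prodMk ((measurable_pi_apply j).comp measurable_snd))

variable (P : Measure D) [IsProbabilityMeasure P]

/-- Weak law of large numbers for the number of hits. -/
lemma tendsto_measure_lt_hits {A : Set D} (hA : MeasurableSet A) {ε : ℝ} (hε : 0 ≤ ε)
    (hlt : ENNReal.ofReal ε < P A) :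
    Tendsto (fun m : ℕ => Measure.pi (fun _ : Fin m => P) {b | ⌊ε * m⌋₊ < hits A b})
      atTop (𝓝 1) := by
  set v := P.real A with hv
  have hεv : ε < v := (ENNReal.ofReal_lt_iff_lt_toReal hε (measure_ne_top P A)).1 hlt
  set X : D → ℝ := A.indicator fun _ => (1 : ℝ) with hX
  have hXm : Measurable X := measurable_const.indicator hA
  have hXmem : MemLp X 2 P := memLp_indicator_const 2 hA 1 (Or.inr (measure_ne_top P A))
  have hvar : Var[X; P] ≤ 1 := by
    refine (variance_le_sq_of_bounded (a := 0) (b := 1) (ae_of_all _ fun d => ?_)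
      hXm.aemeasurable).trans (by norm_num)
    by_cases h : d ∈ A <;> simp [hX, h]
  have hbound : ∀ m : ℕ, 0 < m →
      1 - ENNReal.ofReal (1 / (v - ε) ^ 2 / m)
        ≤ Measure.pi (fun _ : Fin m => P) {b | ⌊ε * m⌋₊ < hits A b} := by
    intro m hm
    have hm' : (0 : ℝ) < m := by exact_mod_cast hm
    set μ := Measure.pi (fun _ : Fin m => P) with hμ
    set Y : (Fin m → D) → ℝ := ∑ i, fun b => X (b i) with hY
    have hcomp : ∀ i : Fin m, MemLp (fun b : Fin m → D => X (b i)) 2 μ := fun i =>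
      hXmem.comp_measurePreserving (measurePreserving_eval (fun _ : Fin m => P) i)
    have hYmem : MemLp Y 2 μ := memLp_finsetSum' _ fun i _ => hcomp i
    have hYvar : Var[Y; μ] ≤ m := by
      rw [hY, hμ, variance_sum_pi (X := fun _ => X) fun _ => hXmem]
      calc ∑ _i : Fin m, Var[X; P] ≤ ∑ _i : Fin m, (1 : ℝ) := Finset.sum_le_sum fun _ _ => hvar
        _ = m := by simp
    have hYint : ∫ b, Y b ∂μ = m * v := by
      simp only [hY, Finset.sum_apply]
      rw [integral_finsetSum _ fun i _ => (hcomp i).integrable (by norm_num)]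
      have : ∀ i : Fin m, ∫ b, X (b i) ∂μ = v := by
        intro i
        rw [integral_comp_eval (μ := fun _ : Fin m => P) (f := X) hXm.aestronglyMeasurable,
          hX, integral_indicator_const _ hA]
        simp [hv]
      simp [this]
    have hcheb := meas_ge_le_variance_div_sq hYmem (c := m * (v - ε))
      (mul_pos hm' (by linarith))
    have hmeas : MeasurableSet {b : Fin m → D | ⌊ε * m⌋₊ < hits A b} := by
      have h1 : Measurable fun b : Fin m → D => hits A b := by
        have := (measurable_hits (m := m) (Ω := Unit) (S := Prod.snd ⁻¹' A)
          (measurable_snd hA)).comp (measurable_const (a := ()).prodMk measurable_id)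
        exact this
      exact measurableSet_lt measurable_const h1
    -- Chebyshev: at most εm hits means a deviation of at least m(v - ε) from the mean mv, while the
    -- variance is at most m.
    rw [← compl_compl {b : Fin m → D | ⌊ε * m⌋₊ < hits A b}, prob_compl_eq_one_sub hmeas.compl]
    refine tsub_le_tsub_left ((measure_mono ?_).trans (hcheb.trans
      (ENNReal.ofReal_le_ofReal ?_))) 1
    · intro b hb
      simp only [mem_compl_iff, mem_ofPred_eq, not_lt] at hb ⊢
      have h1 : (hits A b : ℝ) ≤ ε * m := (Nat.le_floor_iff (by positivity)).1 hb
      rw [hits_eq_sum] at h1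
      have h2 : Y b ≤ ε * m := by simpa [hY, hX] using h1
      rw [hYint, abs_sub_comm]
      refine le_trans ?_ (le_abs_self _)
      nlinarith
    · have hve : 0 < v - ε := by linarith
      calc Var[Y; μ] / (m * (v - ε)) ^ 2 ≤ m / (m * (v - ε)) ^ 2 := by gcongr
        _ = 1 / (v - ε) ^ 2 / m := by field_simp
  have hlim : Tendsto (fun m : ℕ => 1 - ENNReal.ofReal (1 / (v - ε) ^ 2 / m)) atTop (𝓝 1) := by
    have h1 := ENNReal.tendsto_ofReal (tendsto_const_div_atTop_nhds_zero_nat (1 / (v - ε) ^ 2))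
    have h2 := ENNReal.Tendsto.sub (tendsto_const_nhds (x := (1 : ℝ≥0∞))) h1
      (Or.inl ENNReal.one_ne_top)
    simpa using h2
  refine tendsto_of_tendsto_of_tendsto_of_le_of_le' hlim tendsto_const_nhds ?_
    (Eventually.of_forall fun m => prob_le_one)
  filter_upwards [eventually_gt_atTop 0] with m hm using hbound m hm

lemma measurePreserving_split {N m M : ℕ} (e : Fin N ⊕ Fin m ≃ Fin M) :
    MeasurePreserving (fun d : Fin M → D => (fun i => d (e (Sum.inl i)), fun j => d (e (Sum.inr j))))
      (Measure.pi fun _ => P) ((Measure.pi fun _ => P).prod (Measure.pi fun _ => P)) := by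
  have h1 := measurePreserving_piCongrLeft (fun _ : Fin N ⊕ Fin m => P) e.symm
  have h2 := measurePreserving_sumPiEquivProdPi (fun _ : Fin N ⊕ Fin m => P)
  have h3 := h2.comp h1
  convert h3 using 1
  funext d
  have key : ∀ s, (MeasurableEquiv.piCongrLeft (fun _ : Fin N ⊕ Fin m => D) e.symm) d s
      = d (e s) := by
    intro s
    have := MeasurableEquiv.piCongrLeft_apply_apply e.symm (β := fun _ => D) d (e s)
    rwa [e.symm_apply_apply] at this
  refine Prod.ext (funext fun i => ?_) (funext fun j => ?_)
  · exact (key (Sum.inl i)).symm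
  · exact (key (Sum.inr j)).symm

open scoped Classical in
/-- If, among any finite family of samples, the number of `N`-element subfamilies with many
violators is controlled, then the violation probability of `N` random samples has a binomial
tail. -/
theorem measure_violation_le {n N : ℕ} (hnN : n ≤ N) {ε : ℝ} (hε : ε ∈ Icc (0 : ℝ) 1)
    {S : Set ((Fin N → D) × D)} (hS : MeasurableSet S)
    (hcount : ∀ (m k : ℕ) (d : Fin (N + m) → D) (e : Finset (Fin (N + m)) → Fin N → Fin (N + m)),
      (∀ R, R.card = N → range (e R) = R) →
      ((Finset.powersetCard N Finset.univ).filter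
        (fun R => k < hits {x | (d ∘ e R, x) ∈ S} d)).card ≤ lowCount (N + m) N (k + n) n) :
    Measure.pi (fun _ : Fin N => P) {a | ENNReal.ofReal ε < P {x | (a, x) ∈ S}}
      ≤ ENNReal.ofReal (binomTail n N ε) := by
  set μ := Measure.pi (fun _ : Fin N => P) with hμ
  let B : ∀ m : ℕ, Set ((Fin N → D) × (Fin m → D)) := fun m =>
    {p | ⌊ε * m⌋₊ < hits {x | (p.1, x) ∈ S} p.2}
  have hB : ∀ m, MeasurableSet (B m) := fun m =>
    measurableSet_lt measurable_const (measurable_hits hS)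
  let g : ∀ m : ℕ, (Fin N → D) → ℝ≥0∞ := fun m a =>
    Measure.pi (fun _ : Fin m => P) {b | ⌊ε * m⌋₊ < hits {x | (a, x) ∈ S} b}
  have hg : ∀ m, Measurable (g m) := fun m => measurable_measure_prodMk_left (hB m)
  have hint : ∀ m, ∫⁻ a, g m a ∂μ ≤ ENNReal.ofReal
      ((lowCount (N + m) N (⌊ε * m⌋₊ + n) n : ℝ) / ((N + m).choose N : ℝ)) := by
    intro m
    set ν := Measure.pi (fun _ : Fin (N + m) => P)
    have h1 : ∫⁻ a, g m a ∂μ = (μ.prod (Measure.pi fun _ : Fin m => P)) (B m) :=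
      (Measure.prod_apply (hB m)).symm
    let E : Finset (Fin (N + m)) → (Fin N ⊕ Fin m ≃ Fin (N + m)) := fun R =>
      if h : R.card = N then finSumEquivOfFinset h (by rw [Finset.card_compl, h]; simp)
      else finSumFinEquiv
    let Ψ : Finset (Fin (N + m)) → (Fin (N + m) → D) → (Fin N → D) × (Fin m → D) := fun R d =>
      (fun i => d (E R (Sum.inl i)), fun j => d (E R (Sum.inr j)))
    have hΨ : ∀ R, MeasurePreserving (Ψ R) ν (μ.prod (Measure.pi fun _ : Fin m => P)) :=
      fun R => measurePreserving_split P (E R)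
    have hrange : ∀ R : Finset (Fin (N + m)), R.card = N →
        range (fun i => E R (Sum.inl i)) = R := by
      intro R hR
      simp only [E, dif_pos hR, finSumEquivOfFinset_inl]
      exact Finset.range_orderEmbOfFin R hR
    have hpt : ∀ d, ∑ R ∈ Finset.powersetCard N (Finset.univ : Finset (Fin (N + m))),
        (Ψ R ⁻¹' B m).indicator (fun _ => (1 : ℝ≥0∞)) d
          ≤ (lowCount (N + m) N (⌊ε * m⌋₊ + n) n : ℝ≥0∞) := by
      intro d
      simp only [indicator_apply, Finset.sum_boole]
      norm_cast
      refine le_trans (Finset.card_le_card fun R hR => ?_)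
        (hcount m ⌊ε * m⌋₊ d (fun R i => E R (Sum.inl i)) hrange)
      rw [Finset.mem_filter] at hR ⊢
      refine ⟨hR.1, lt_of_lt_of_le hR.2 ?_⟩
      refine Finset.card_le_card_of_injOn (fun j => E R (Sum.inr j)) ?_ ?_
      · intro j hj
        simpa [Ψ, Function.comp_def] using hj
      · intro j _ j' _ h
        simpa using h
    -- Exchangeability: every choice of the `N` defining samples has the same probability, so
    -- summing over all `R` multiplies it by the binomial coefficient.
    have hsum : ((N + m).choose N : ℝ≥0∞) * ∫⁻ a, g m a ∂μ
        ≤ (lowCount (N + m) N (⌊ε * m⌋₊ + n) n : ℝ≥0∞) := by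
      calc ((N + m).choose N : ℝ≥0∞) * ∫⁻ a, g m a ∂μ
          = ∑ R ∈ Finset.powersetCard N (Finset.univ : Finset (Fin (N + m))),
              ν (Ψ R ⁻¹' B m) := by
            rw [Finset.sum_congr rfl fun R _ => (hΨ R).measure_preimage (hB m).nullMeasurableSet,
              Finset.sum_const, Finset.card_powersetCard, Finset.card_univ, Fintype.card_fin,
              nsmul_eq_mul, h1]
        _ = ∫⁻ d, ∑ R ∈ Finset.powersetCard N (Finset.univ : Finset (Fin (N + m))),
              (Ψ R ⁻¹' B m).indicator (fun _ => (1 : ℝ≥0∞)) d ∂ν := by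
            rw [lintegral_finsetSum _ fun R _ =>
              measurable_const.indicator ((hΨ R).measurable (hB m))]
            refine Finset.sum_congr rfl fun R _ => ?_
            rw [lintegral_indicator_const ((hΨ R).measurable (hB m)), one_mul]
        _ ≤ ∫⁻ _, (lowCount (N + m) N (⌊ε * m⌋₊ + n) n : ℝ≥0∞) ∂ν := lintegral_mono hpt
        _ = _ := by simp [ν]
    have hC : 0 < (N + m).choose N := Nat.choose_pos (by omega)
    rw [ENNReal.ofReal_div_of_pos (by exact_mod_cast hC), ENNReal.ofReal_natCast,
      ENNReal.ofReal_natCast, ENNReal.le_div_iff_mul_le (Or.inl (by exact_mod_cast hC.ne'))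
      (Or.inl (ENNReal.natCast_ne_top _)), mul_comm]
    exact hsum
  have hSa : ∀ a, MeasurableSet {x | (a, x) ∈ S} := fun a => measurable_prodMk_left hS
  have hbad : MeasurableSet {a | ENNReal.ofReal ε < P {x | (a, x) ∈ S}} :=
    measurableSet_lt measurable_const (measurable_measure_prodMk_left hS)
  calc μ {a | ENNReal.ofReal ε < P {x | (a, x) ∈ S}}
      = ∫⁻ a, {a | ENNReal.ofReal ε < P {x | (a, x) ∈ S}}.indicator (fun _ => (1 : ℝ≥0∞)) a ∂μ := by
        rw [lintegral_indicator_const hbad, one_mul]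
    -- Where the violation probability exceeds `ε`, `g m a` tends to 1, so the liminf dominates the
    -- indicator; Fatou's lemma follows.
    _ ≤ ∫⁻ a, liminf (fun m => g m a) atTop ∂μ := by
        refine lintegral_mono fun a => ?_
        by_cases ha : ENNReal.ofReal ε < P {x | (a, x) ∈ S}
        · rw [indicator_of_mem (by exact ha),
            (tendsto_measure_lt_hits P (hSa a) hε.1 ha).liminf_eq]
        · rw [indicator_of_notMem (by exact ha)]
          exact zero_le
    _ ≤ liminf (fun m => ∫⁻ a, g m a ∂μ) atTop := lintegral_liminf_le hg
    _ ≤ liminf (fun m : ℕ => ENNReal.ofReal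
          ((lowCount (N + m) N (⌊ε * m⌋₊ + n) n : ℝ) / ((N + m).choose N : ℝ))) atTop :=
        liminf_le_liminf (Eventually.of_forall hint)
    _ = ENNReal.ofReal (binomTail n N ε) :=
        (ENNReal.tendsto_ofReal (tendsto_lowCount_div hnN hε)).liminf_eq

end Sampling

/-- The optimizer of a convex scenario program violates the constraint with probability more than
`ε` at most with the probability given by the binomial tail. -/
theorem measure_optimizer_violation_le {n : ℕ} {D : Type*} [MeasurableSpace D] (P : Measure D)
    [IsProbabilityMeasure P] {X : Set (Fin n → ℝ)} {c : Fin n → ℝ} {f : (Fin n → ℝ) → D → ℝ}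
    (hXc : IsCompact X) (hX : Convex ℝ X) (hfm : ∀ x ∈ X, Measurable (f x))
    (hfc : ∀ d, ConvexOn ℝ X (fun x => f x d)) {x₀ : Fin n → ℝ} (hx₀ : x₀ ∈ X)
    (hneg : ∀ d, f x₀ d < 0) {N : ℕ} (hnN : n ≤ N) {xs : (Fin N → D) → Fin n → ℝ}
    (hxs : ∀ d, IsUniqueMinimizer c (scpFeasible X f d) (xs d)) {ε : ℝ}
    (hε : ε ∈ Icc (0 : ℝ) 1) :
    Measure.pi (fun _ : Fin N => P) {a | ENNReal.ofReal ε < P {d | 0 < f (xs a) d}}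
      ≤ ENNReal.ofReal (binomTail n N ε) := by
  classical
  refine measure_violation_le P hnN hε (measurableSet_violation hX hfm hfc hx₀ hneg hnN hxs) ?_
  intro m k d e he
  refine card_violations_le hXc hX c (C := fun j => {x | x ∈ X ∧ f x (d j) ≤ 0})
    (fun j => (hfc (d j)).convex_le 0) hx₀ (fun j => ⟨hx₀, (hneg _).le⟩) hnN
    (x := fun R => xs (d ∘ e R)) (fun R hR => ?_)
    (W := fun R => Finset.univ.filter fun j => d j ∈ {x | 0 < f (xs (d ∘ e R)) x})
    (fun R hR j hj h => ?_) k
  · have h := hxs (d ∘ e R)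
    have hmem : ∀ j ∈ R, ∃ i, e R i = j := fun j hj => by
      have : j ∈ range (e R) := by rw [he R hR]; exact hj
      exact this
    refine ⟨h.1.1, fun j hj => ⟨h.1.1, ?_⟩, fun y hy hyR hle => h.2 y ⟨hy, fun i => ?_⟩ hle⟩
    · obtain ⟨i, rfl⟩ := hmem j hj
      exact h.1.2 i
    · refine (hyR (e R i) ?_).2
      have : e R i ∈ (R : Set (Fin (N + m))) := he R hR ▸ mem_range_self i
      exact this
  · exact absurd h.2 (not_le.2 (Finset.mem_filter.1 hj).2)

/-! ### Value gaps: Slater point, duality and level-set bound -/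

section Deterministic

variable {n : ℕ} {D : Type*} {X : Set (Fin n → ℝ)} {c : Fin n → ℝ} {f : (Fin n → ℝ) → D → ℝ}

lemma continuous_dotProduct_left (c : Fin n → ℝ) : Continuous fun x : Fin n → ℝ => c ⬝ᵥ x := by
  unfold dotProduct; fun_prop

lemma bddBelow_image (hXc : IsCompact X) {S : Set (Fin n → ℝ)} (hS : S ⊆ X) :
    BddBelow ((fun x => c ⬝ᵥ x) '' S) :=
  ((hXc.image (continuous_dotProduct_left c)).bddBelow).mono (image_mono hS)

lemma bddAbove_image (hXc : IsCompact X) : BddAbove ((fun x => c ⬝ᵥ x) '' X) :=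
  (hXc.image (continuous_dotProduct_left c)).bddAbove

lemma optVal_le (hXc : IsCompact X) {S : Set (Fin n → ℝ)} (hS : S ⊆ X) {x : Fin n → ℝ}
    (hx : x ∈ S) : optVal c S ≤ c ⬝ᵥ x :=
  csInf_le (bddBelow_image hXc hS) (mem_image_of_mem _ hx)

lemma le_optVal {S : Set (Fin n → ℝ)} (hne : S.Nonempty) {r : ℝ} (h : ∀ x ∈ S, r ≤ c ⬝ᵥ x) :
    r ≤ optVal c S :=
  le_csInf (hne.image _) (by rintro _ ⟨x, hx, rfl⟩; exact h x hx)

lemma le_maxVal (hXc : IsCompact X) {x : Fin n → ℝ} (hx : x ∈ X) : c ⬝ᵥ x ≤ maxVal c X :=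
  le_csSup (bddAbove_image hXc) (mem_image_of_mem _ hx)

lemma IsUniqueMinimizer.optVal_eq {S : Set (Fin n → ℝ)} {x : Fin n → ℝ}
    (h : IsUniqueMinimizer c S x) : optVal c S = c ⬝ᵥ x :=
  IsLeast.csInf_eq ⟨mem_image_of_mem _ h.1, by rintro _ ⟨y, hy, rfl⟩; exact h.le hy⟩

lemma le_intervalLength {L : ℝ} {η : ℝ≥0∞} {r : ℝ} (h1 : ENNReal.ofReal r ≤ ENNReal.ofReal L * η)
    (h2 : r ≤ maxVal c X - optVal c X) : r ≤ intervalLength X c L η := by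
  rw [intervalLength, ← ENNReal.ofReal_le_iff_le_toReal]
  · exact le_min h1 (ENNReal.ofReal_le_ofReal h2)
  · exact (min_lt_of_right_lt ENNReal.ofReal_lt_top).ne

/-- The multiplier form of strong duality under Slater's condition. -/
lemma exists_multiplier (hX : Convex ℝ X) (hfc : ∀ d, ConvexOn ℝ X (fun x => f x d))
    {x₀ : Fin n → ℝ} (hx₀ : x₀ ∈ X) (hneg : ∀ d, f x₀ d < 0) {N : ℕ} (d : Fin N → D) {J : ℝ}
    (hJ : ∀ x ∈ scpFeasible X f d, J ≤ c ⬝ᵥ x) :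
    ∃ m : Fin N → ℝ, (∀ i, 0 ≤ m i) ∧ ∀ x ∈ X, J ≤ c ⬝ᵥ x + ∑ i, m i * f x (d i) := by
  -- Strict inequalities make this set of attainable bounds open, so (0, J) can be separated from
  -- it.
  let U : Set ((Fin N → ℝ) × ℝ) := {p | ∃ x ∈ X, (∀ i, f x (d i) < p.1 i) ∧ c ⬝ᵥ x < p.2}
  have hUo : IsOpen U := by
    have : U = ⋃ x ∈ X, {p : (Fin N → ℝ) × ℝ | (∀ i, f x (d i) < p.1 i) ∧ c ⬝ᵥ x < p.2} := by
      ext p; simp only [U, mem_ofPred_eq, mem_iUnion, exists_prop]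
    rw [this]
    refine isOpen_biUnion fun x _ => IsOpen.and ?_ (isOpen_lt continuous_const continuous_snd)
    simp only [ofPred_forall]
    exact isOpen_iInter_of_finite fun i => isOpen_lt continuous_const (by fun_prop)
  have hUc : Convex ℝ U := by
    rintro p ⟨x, hx, hxp, hxc⟩ q ⟨y, hy, hyq, hyc⟩ a b ha hb hab
    have key : ∀ {r s r' s' : ℝ}, r < r' → s < s' → a * r + b * s < a * r' + b * s' := by
      intro r s r' s' h1 h2
      rcases ha.eq_or_lt with rfl | ha'
      · have : b = 1 := by linarith
        subst this; linarith
      · have := mul_lt_mul_of_pos_left h1 ha'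
        have := mul_le_mul_of_nonneg_left h2.le hb
        linarith
    refine ⟨a • x + b • y, hX hx hy ha hb hab, fun i => ?_, ?_⟩
    · refine ((hfc (d i)).2 hx hy ha hb hab).trans_lt ?_
      exact key (hxp i) (hyq i)
    · simp only [dotProduct_add, dotProduct_smul, smul_eq_mul, Prod.snd_add, Prod.smul_snd]
      exact key hxc hyc
  have hUn : ((0 : Fin N → ℝ), J) ∉ U := by
    rintro ⟨x, hx, hxf, hxc⟩
    exact absurd (hJ x ⟨hx, fun i => (hxf i).le⟩) (not_le.2 hxc)
  obtain ⟨g, hg⟩ := geometric_hahn_banach_open_point hUc hUo hUn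
  set w : Fin N → ℝ := fun i => -g (Pi.single i 1, 0) with hw
  set μ : ℝ := -g (0, 1) with hμ
  have hgf : ∀ (u : Fin N → ℝ) (r : ℝ), g (u, r) = -(∑ i, w i * u i + μ * r) := by
    intro u r
    have e : (u, r) = ∑ i, u i • ((Pi.single i 1 : Fin N → ℝ), (0 : ℝ))
        + r • ((0 : Fin N → ℝ), (1 : ℝ)) := by
      refine Prod.ext ?_ ?_
      · funext j
        simp [Prod.fst_sum, Finset.sum_apply, Pi.single_apply]
      · simp [Prod.snd_sum]
    rw [e, map_add, map_sum]
    simp only [map_smul, smul_eq_mul, hw, hμ]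
    rw [neg_add, ← Finset.sum_neg_distrib]
    congr 1
    · refine Finset.sum_congr rfl fun i _ => ?_
      ring
    · ring
  have hstrict : ∀ x ∈ X, ∀ s : Fin N → ℝ, (∀ i, 0 < s i) → ∀ t, 0 < t →
      μ * J < ∑ i, w i * (f x (d i) + s i) + μ * (c ⬝ᵥ x + t) := by
    intro x hx s hs t ht
    have h := hg (fun i => f x (d i) + s i, c ⬝ᵥ x + t)
      ⟨x, hx, fun i => by simpa using hs i, by simpa using ht⟩
    rw [hgf, hgf] at h
    simp only [Pi.zero_apply, mul_zero, Finset.sum_const_zero, zero_add] at h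
    linarith
  have hw0 : ∀ j, 0 ≤ w j := by
    intro j
    by_contra! hneg'
    set Cst := ∑ i, w i * (f x₀ (d i) + 1) + μ * (c ⬝ᵥ x₀ + 1) - μ * J with hCst
    have h1 := hstrict x₀ hx₀ (fun i => 1 + if i = j then |Cst| / (-w j) else 0) (fun i => by
      have : 0 ≤ |Cst| / (-w j) := div_nonneg (abs_nonneg _) (by linarith)
      split_ifs <;> linarith) 1 one_pos
    have h2 : ∑ i, w i * (f x₀ (d i) + (1 + if i = j then |Cst| / (-w j) else 0))
        = ∑ i, w i * (f x₀ (d i) + 1) + w j * (|Cst| / (-w j)) := by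
      simp only [← add_assoc]
      simp only [mul_add (w _) (f x₀ (d _) + 1), Finset.sum_add_distrib, mul_ite, mul_zero,
        Finset.sum_ite_eq', Finset.mem_univ, if_true]
    have h3 : w j * (|Cst| / (-w j)) = -|Cst| := by
      have := hneg'.ne
      field_simp
    rw [h2, h3] at h1
    have := le_abs_self Cst
    linarith
  have hμ0 : 0 ≤ μ := by
    by_contra! hneg'
    set Cst := ∑ i, w i * (f x₀ (d i) + 1) + μ * (c ⬝ᵥ x₀ + 1) - μ * J with hCst
    have h1 := hstrict x₀ hx₀ (fun _ => 1) (fun _ => one_pos) (1 + |Cst| / (-μ)) (by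
      have : 0 ≤ |Cst| / (-μ) := div_nonneg (abs_nonneg _) (by linarith)
      linarith)
    have h3 : μ * (c ⬝ᵥ x₀ + (1 + |Cst| / (-μ))) = μ * (c ⬝ᵥ x₀ + 1) - |Cst| := by
      have := hneg'.ne
      field_simp
      ring
    rw [h3] at h1
    have := le_abs_self Cst
    linarith
  -- Slater's condition excludes a vertical hyperplane: the slacks -f(x₀, dᵢ) turn the separation
  -- into 0 < 0 when μ = 0.
  have hμpos : 0 < μ := by
    refine lt_of_le_of_ne hμ0 fun h0 => ?_
    have h1 := hstrict x₀ hx₀ (fun i => -f x₀ (d i)) (fun i => by linarith [hneg (d i)]) 1 one_pos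
    rw [← h0] at h1
    simp at h1
  have hweak : ∀ x ∈ X, μ * J ≤ ∑ i, w i * f x (d i) + μ * (c ⬝ᵥ x) := by
    intro x hx
    have hcont : Continuous fun t : ℝ => ∑ i, w i * (f x (d i) + t) + μ * (c ⬝ᵥ x + t) := by
      fun_prop
    have hlim := (hcont.tendsto 0).mono_left (nhdsWithin_le_nhds (s := Ioi 0))
    simp only [add_zero] at hlim
    refine ge_of_tendsto hlim ?_
    filter_upwards [self_mem_nhdsWithin] with t ht
    exact (hstrict x hx (fun _ => t) (fun _ => ht) t ht).le
  refine ⟨fun i => w i / μ, fun i => div_nonneg (hw0 i) hμ0, fun x hx => ?_⟩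
  have h1 := hweak x hx
  have h2 : ∑ i, w i / μ * f x (d i) = (∑ i, w i * f x (d i)) / μ := by
    rw [Finset.sum_div]
    exact Finset.sum_congr rfl fun i _ => by ring
  rw [h2]
  have h3 : c ⬝ᵥ x + (∑ i, w i * f x (d i)) / μ
      = (∑ i, w i * f x (d i) + μ * (c ⬝ᵥ x)) / μ := by
    field_simp
    ring
  rw [h3, le_div_iff₀ hμpos]
  linarith

/-- A dual optimizer satisfies strong duality. -/
lemma IsDualOptimizer.le_lagrangian (hX : Convex ℝ X)
    (hfc : ∀ d, ConvexOn ℝ X (fun x => f x d)) {x₀ : Fin n → ℝ} (hx₀ : x₀ ∈ X)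
    (hneg : ∀ d, f x₀ d < 0) {N : ℕ} {d : Fin N → D} {l : Fin N → ℝ}
    (hl : IsDualOptimizer X c f d l) {J : ℝ} (hJ : ∀ x ∈ scpFeasible X f d, J ≤ c ⬝ᵥ x)
    {x : Fin n → ℝ} (hx : x ∈ X) : J ≤ c ⬝ᵥ x + ∑ i, l i * f x (d i) := by
  obtain ⟨m, hm, hmJ⟩ := exists_multiplier hX hfc hx₀ hneg d hJ
  have h1 : (J : EReal) ≤ scpDual X c f d m :=
    le_iInf₂ fun y hy => EReal.coe_le_coe_iff.2 (hmJ y hy)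
  have h2 : scpDual X c f d l ≤ ((c ⬝ᵥ x + ∑ i, l i * f x (d i) : ℝ) : EReal) := iInf₂_le x hx
  exact EReal.coe_le_coe_iff.1 ((h1.trans (hl.2 m hm)).trans h2)

/-- Value gap controlled by the Slater constant. -/
lemma optVal_sub_le_slaterConst_mul (hXc : IsCompact X) (hX : Convex ℝ X)
    (hfc : ∀ d, ConvexOn ℝ X (fun x => f x d)) {x₀ : Fin n → ℝ} (hx₀ : x₀ ∈ X)
    (hbdd : BddAbove (range (f x₀))) (hslater : (⨆ d, f x₀ d) < 0) {N : ℕ} (d : Fin N → D)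
    {x : Fin n → ℝ} (hx : x ∈ X) {δ : ℝ} (hδ : 0 ≤ δ) (hxδ : ∀ v, f x v ≤ δ) :
    optVal c (scpFeasible X f d) - c ⬝ᵥ x ≤ slaterConst X c f x₀ * δ := by
  set s := -⨆ d, f x₀ d with hs
  have hspos : 0 < s := by linarith
  have hfs : ∀ v, f x₀ v ≤ -s := fun v => by rw [hs, neg_neg]; exact le_ciSup hbdd v
  -- This weight makes (1 - t)δ - ts = 0, exactly what feasibility of the combination with `x₀`
  -- needs.
  set t := δ / (δ + s) with ht
  have hden : 0 < δ + s := by linarith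
  have ht0 : 0 ≤ t := div_nonneg hδ hden.le
  have ht1 : t ≤ 1 := (div_le_one hden).2 (by linarith)
  have hy : (1 - t) • x + t • x₀ ∈ scpFeasible X f d := by
    refine ⟨hX hx hx₀ (by linarith) ht0 (by ring), fun i => ?_⟩
    refine ((hfc (d i)).2 hx hx₀ (by linarith) ht0 (by ring)).trans ?_
    have h1 := mul_le_mul_of_nonneg_left (hxδ (d i)) (by linarith : 0 ≤ 1 - t)
    have h2 := mul_le_mul_of_nonneg_left (hfs (d i)) ht0
    have h3 : (1 - t) * δ + t * (-s) = 0 := by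
      rw [ht]; field_simp; ring
    simp only [smul_eq_mul]
    linarith
  have h1 := optVal_le (c := c) hXc (fun _ h => h.1) hy
  have h2 : c ⬝ᵥ ((1 - t) • x + t • x₀) = c ⬝ᵥ x + t * (c ⬝ᵥ x₀ - c ⬝ᵥ x) := by
    simp only [dotProduct_add, dotProduct_smul, smul_eq_mul]; ring
  have h3 := optVal_le (c := c) hXc subset_rfl hx
  have h4 := optVal_le (c := c) hXc subset_rfl hx₀
  have hts : t ≤ δ / s := div_le_div_of_nonneg_left hδ hspos (by linarith)
  have h5 : slaterConst X c f x₀ * δ = δ / s * (c ⬝ᵥ x₀ - optVal c X) := by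
    have e : (⨆ d, f x₀ d) = -s := by rw [hs, neg_neg]
    rw [slaterConst, e]
    field_simp
    ring
  rw [h5]
  have h6 : t * (c ⬝ᵥ x₀ - c ⬝ᵥ x) ≤ t * (c ⬝ᵥ x₀ - optVal c X) :=
    mul_le_mul_of_nonneg_left (by linarith) ht0
  have h7 : t * (c ⬝ᵥ x₀ - optVal c X) ≤ δ / s * (c ⬝ᵥ x₀ - optVal c X) :=
    mul_le_mul_of_nonneg_right hts (by linarith)
  linarith

/-- Value gap controlled by the norm of a dual optimizer. -/
lemma optVal_sub_le_dual_mul (hXc : IsCompact X) (hX : Convex ℝ X)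
    (hfc : ∀ d, ConvexOn ℝ X (fun x => f x d)) {x₀ : Fin n → ℝ} (hx₀ : x₀ ∈ X)
    (hneg : ∀ d, f x₀ d < 0) {N : ℕ} {d : Fin N → D} {l : Fin N → ℝ}
    (hl : IsDualOptimizer X c f d l) {x : Fin n → ℝ} (hx : x ∈ X) {δ : ℝ}
    (hxδ : ∀ v, f x v ≤ δ) :
    optVal c (scpFeasible X f d) - c ⬝ᵥ x ≤ (∑ i, |l i|) * δ := by
  have h1 := hl.le_lagrangian hX hfc hx₀ hneg
    (fun y hy => optVal_le (c := c) hXc (S := scpFeasible X f d) (fun _ h => h.1) hy) hx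
  have h2 : ∑ i, l i * f x (d i) ≤ (∑ i, |l i|) * δ := by
    rw [Finset.sum_mul]
    refine Finset.sum_le_sum fun i _ => ?_
    rw [abs_of_nonneg (hl.1 i)]
    exact mul_le_mul_of_nonneg_left (hxδ _) (hl.1 i)
  linarith

variable [MeasurableSpace D] {P : Measure D}

/-- A uniform level-set bound controls the worst-case violation of the points that are feasible
for the chance-constrained program. -/
lemma IsULB.worst_case_le {h : ℝ → ℝ≥0∞} (hULB : IsULB X f P h) {ε : ℝ}
    (hε : ε ∈ Icc (0 : ℝ) 1) {x : Fin n → ℝ} (hx : x ∈ X)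
    (hviol : P {d | 0 < f x d} ≤ ENNReal.ofReal ε) :
    ENNReal.ofReal (⨆ v, f x v) ≤ h ε := by
  rcases le_or_gt (⨆ v, f x v) 0 with hle | hpos
  · rw [ENNReal.ofReal_of_nonpos hle]; exact zero_le
  -- At δ = sup f(x,·), the tail probability of `x` is the violation probability, so δ belongs to
  -- the set whose supremum `h ε` bounds.
  refine le_trans (le_sSup (mem_image_of_mem (fun δ : ℝ≥0 => (δ : ℝ≥0∞))
    (show (⨆ v, f x v).toNNReal ∈ {δ : ℝ≥0 | (⨅ x ∈ X, tailProb f P x δ) ≤ ENNReal.ofReal ε} from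
      ?_))) (hULB ε hε)
  refine (iInf₂_le x hx).trans (le_trans (le_of_eq ?_) hviol)
  rw [tailProb, Real.coe_toNNReal _ hpos.le, sub_self]

variable [IsProbabilityMeasure P]

lemma measure_pos_le_iff {x : Fin n → ℝ} {ε : ℝ} (hε : ε ∈ Icc (0 : ℝ) 1)
    (hfx : Measurable (f x)) :
    P {d | 0 < f x d} ≤ ENNReal.ofReal ε ↔ ENNReal.ofReal (1 - ε) ≤ P {d | f x d ≤ 0} := by
  have hm : MeasurableSet {d | 0 < f x d} := measurableSet_lt measurable_const hfx
  have hc : {d | f x d ≤ 0} = {d | 0 < f x d}ᶜ := by ext d; simp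
  rw [hc, prob_compl_eq_one_sub hm, ENNReal.ofReal_sub _ hε.1, ENNReal.ofReal_one]
  constructor
  · exact fun h => tsub_le_tsub_left h 1
  · exact (ENNReal.sub_le_sub_iff_left prob_le_one ENNReal.one_ne_top).1

/-- On the event that the scenario optimizer is feasible for the chance-constrained program, any
bound on the value gap in terms of the worst-case violation yields the confidence interval. -/
lemma optVal_sub_mem_Icc (hXc : IsCompact X) {h : ℝ → ℝ≥0∞} (hULB : IsULB X f P h) {ε : ℝ}
    (hε : ε ∈ Icc (0 : ℝ) 1) (hfm : ∀ x ∈ X, Measurable (f x))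
    (hbdd : ∀ x ∈ X, BddAbove (range (f x))) {N : ℕ} {d : Fin N → D} {z : Fin n → ℝ}
    (hz : IsUniqueMinimizer c (scpFeasible X f d) z)
    (hviol : P {v | 0 < f z v} ≤ ENNReal.ofReal ε) {L : ℝ}
    (hgap : ∀ x ∈ X, ∀ δ, 0 ≤ δ → (∀ v, f x v ≤ δ) →
      optVal c (scpFeasible X f d) - c ⬝ᵥ x ≤ L * δ) :
    optVal c (ccpFeasible X f P ε) - optVal c (scpFeasible X f d)
      ∈ Icc (-intervalLength X c L (h ε)) 0 := by
  have hzc : z ∈ ccpFeasible X f P ε :=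
    ⟨hz.1.1, (measure_pos_le_iff hε (hfm z hz.1.1)).1 hviol⟩
  constructor
  · suffices optVal c (scpFeasible X f d) - intervalLength X c L (h ε)
        ≤ optVal c (ccpFeasible X f P ε) by linarith
    refine le_optVal ⟨z, hzc⟩ fun x hx => ?_
    suffices optVal c (scpFeasible X f d) - c ⬝ᵥ x ≤ intervalLength X c L (h ε) by linarith
    refine le_intervalLength ?_ ?_
    -- The supremum may be negative, whereas the gap bound needs a nonnegative relaxation.
    · set δ := max (⨆ v, f x v) 0 with hδ
      have hδh : ENNReal.ofReal δ ≤ h ε := by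
        have := hULB.worst_case_le hε hx.1
          ((measure_pos_le_iff hε (hfm x hx.1)).2 hx.2)
        rw [hδ]
        rcases max_cases (⨆ v, f x v) 0 with hm | hm <;> rw [hm.1]
        · exact this
        · simp
      refine (ENNReal.ofReal_le_ofReal (hgap x hx.1 δ (le_max_right _ _) fun v =>
        (le_ciSup (hbdd x hx.1) v).trans (le_max_left _ _))).trans ?_
      rw [ENNReal.ofReal_mul' (le_max_right _ _)]
      gcongr
    · rw [hz.optVal_eq]
      have h1 := le_maxVal (c := c) hXc hz.1.1
      have h2 := optVal_le (c := c) hXc subset_rfl hx.1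
      linarith
  · rw [hz.optVal_eq]
    have := optVal_le (c := c) hXc (S := ccpFeasible X f P ε) (fun _ h => h.1) hzc
    linarith

end Deterministic

/-! ### Sample size and conclusion -/

lemma binomTail_le_of_sampleSize_le {n N : ℕ} {ε β : ℝ} (hε : ε ∈ Icc (0 : ℝ) 1)
    (hN : sampleSize n ε β ≤ (N : ℕ∞)) : binomTail n N ε ≤ β := by
  set T : Set ℕ := {N : ℕ | ∑ i ∈ Finset.range n,
    (N.choose i : ℝ) * ε ^ i * (1 - ε) ^ (N - i) ≤ β} with hT
  have hne : ((fun N : ℕ => (N : ℕ∞)) '' T).Nonempty := by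
    by_contra hempty
    rw [not_nonempty_iff_eq_empty] at hempty
    rw [sampleSize, ← hT, hempty, sInf_empty] at hN
    exact absurd hN (not_le.2 (ENat.natCast_lt_top N))
  obtain ⟨N', hN', he⟩ := csInf_mem hne
  have hle : N' ≤ N := by
    have : ((N' : ℕ) : ℕ∞) ≤ N := he.trans_le hN
    exact_mod_cast this
  exact (binomTail_antitone n hε hle).trans hN'

end ScenarioProgram

theorem theorem3p6
    {n : ℕ} {D : Type*} [MetricSpace D] [MeasurableSpace D] [BorelSpace D]
    (P : Measure D) [IsProbabilityMeasure P]
    (X : Set (Fin n → ℝ)) (c : Fin n → ℝ) (f : (Fin n → ℝ) → D → ℝ)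
    (hXcompact : IsCompact X) (hXconvex : Convex ℝ X)
    (hfmeas : Measurable (fun p : X × D => f p.1 p.2))
    (hfconvex : ∀ d, ConvexOn ℝ X (fun x => f x d))
    (hfbdd : ∀ x ∈ X, Bornology.IsBounded (range (f x)))
    (x₀ : Fin n → ℝ) (hx₀ : x₀ ∈ X) (hslater : (⨆ d, f x₀ d) < 0)
    (h : ℝ → ℝ≥0∞) (hULB : ScenarioProgram.IsULB X f P h)
    (ε β : ℝ) (hε : ε ∈ Icc (0 : ℝ) 1) (hβ : β ∈ Icc (0 : ℝ) 1)
    (N : ℕ) (hopt : ScenarioProgram.HasMeasurableOptimizer X c f N)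
    (hN : ScenarioProgram.sampleSize n ε β ≤ (N : ℕ∞)) :
    ScenarioProgram.ProbAtLeast (Measure.pi (fun _ : Fin N => P)) (1 - β)
      {d : Fin N → D |
        ScenarioProgram.optVal c (ScenarioProgram.ccpFeasible X f P ε)
            - ScenarioProgram.optVal c (ScenarioProgram.scpFeasible X f d)
          ∈ Icc (-ScenarioProgram.intervalLength X c
                  (ScenarioProgram.slaterConst X c f x₀) (h ε)) 0} ∧
    ∀ lam : (Fin N → D) → (Fin N → ℝ),
      (∀ d, ScenarioProgram.IsDualOptimizer X c f d (lam d)) →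
      ScenarioProgram.ProbAtLeast (Measure.pi (fun _ : Fin N => P)) (1 - β)
        {d : Fin N → D |
          ScenarioProgram.optVal c (ScenarioProgram.ccpFeasible X f P ε)
              - ScenarioProgram.optVal c (ScenarioProgram.scpFeasible X f d)
            ∈ Icc (-ScenarioProgram.intervalLength X c (∑ i, |lam d i|) (h ε)) 0} := by
  obtain ⟨xs, -, hxs⟩ := hopt
  have hfm : ∀ x ∈ X, Measurable (f x) := fun x hx =>
    hfmeas.comp (measurable_const (a := (⟨x, hx⟩ : X)).prodMk measurable_id)
  have hbdd : ∀ x ∈ X, BddAbove (range (f x)) := fun x hx => (hfbdd x hx).bddAbove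
  have hneg : ∀ d, f x₀ d < 0 := fun d => (le_ciSup (hbdd x₀ hx₀) d).trans_lt hslater
  have htail := ScenarioProgram.binomTail_le_of_sampleSize_le hε hN
  -- One measurable event serves both statements and every choice of multipliers, so `lam` needs no
  -- measurability.
  obtain ⟨G, hGm, hGv, hGP⟩ : ∃ G : Set (Fin N → D), MeasurableSet G ∧
      (∀ a ∈ G, P {d | 0 < f (xs a) d} ≤ ENNReal.ofReal ε) ∧
      ENNReal.ofReal (1 - β) ≤ Measure.pi (fun _ : Fin N => P) G := by
    rcases lt_or_ge N n with hNn | hnN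
    -- For N < n the tail is the whole binomial sum 1, so β ≥ 1 and the empty event suffices.
    · rw [ScenarioProgram.binomTail_of_lt hNn] at htail
      exact ⟨∅, MeasurableSet.empty, fun a ha => absurd ha (notMem_empty a), by
        rw [ENNReal.ofReal_of_nonpos (by linarith)]; exact zero_le⟩
    · have hbad := ScenarioProgram.measure_optimizer_violation_le P hXcompact hXconvex hfm
        hfconvex hx₀ hneg hnN hxs hε
      have hmeas : MeasurableSet {a | ENNReal.ofReal ε < P {d | 0 < f (xs a) d}} :=
        measurableSet_lt measurable_const (measurable_measure_prodMk_left
          (ScenarioProgram.measurableSet_violation hXconvex hfm hfconvex hx₀ hneg hnN hxs))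
      refine ⟨_, hmeas.compl, fun a ha => not_lt.1 ha, ?_⟩
      rw [prob_compl_eq_one_sub hmeas, ENNReal.ofReal_sub _ hβ.1, ENNReal.ofReal_one]
      exact tsub_le_tsub_left (hbad.trans (ENNReal.ofReal_le_ofReal htail)) 1
  refine ⟨⟨G, hGm, fun d hd => ?_, hGP⟩, fun lam hlam => ⟨G, hGm, fun d hd => ?_, hGP⟩⟩
  · exact ScenarioProgram.optVal_sub_mem_Icc hXcompact hULB hε hfm hbdd (hxs d) (hGv d hd)
      fun x hx δ hδ hxδ => ScenarioProgram.optVal_sub_le_slaterConst_mul hXcompact hXconvex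
        hfconvex hx₀ (hbdd x₀ hx₀) hslater d hx hδ hxδ
  · exact ScenarioProgram.optVal_sub_mem_Icc hXcompact hULB hε hfm hbdd (hxs d) (hGv d hd)
      fun x hx δ _ hxδ => ScenarioProgram.optVal_sub_le_dual_mul hXcompact hXconvex
        hfconvex hx₀ hneg (hlam d) hx hxδ
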